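/- Notation. Write $dA=dx\,dy/\pi$, $\bar\partial=\frac12(\partial_x+i\partial_y)$ and $\Delta=\frac14(\partial_x^2+\partial_y^2)$. A function $g:\mathbb C\to\mathbb R$ is of class $\mathcal C^{1,1}(\mathbb C)$ if it is $\mathcal C^1$ and its gradient is locally Lipschitz; then $\Delta g$ exists a.e. and is locally bounded, and $g$ is called strictly subharmonic if $\Delta g>0$ a.e. on $\mathbb C$. For $\phi\in\mathcal C^{1,1}(\mathbb C)$ and a positive integer $n$ let $L^2_\phi=L^2(\mathbb C;e^{-\phi}dA)$, with norm $\|u\|_\phi^2=\int_{\mathbb C}|u|^2e^{-\phi}\,dA$; let $A^2_\phi$ be the set of entire functions in $L^2_\phi$; let $L^2_{\phi,n}$ be the set of $u\in L^2_\phi$ with $u(z)=O(|z|^{n-1})$ as $z\to\infty$ (up to null sets); and let $A^2_{\phi,n}=L^2_{\phi,n}\cap A^2_\phi$. An $L^2_{\phi,n}$-minimal solution to $\bar\partial u=f$ is a $u\in L^2_{\phi,n}$ that solves this equation in the sense of distributions and minimizes $\|u\|_\phi$ among all such solutions in $L^2_{\phi,n}$. Theorem. Let $\Sigma$ be a compact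 subset of $\mathbb C$, let $\phi,\widehat\phi,\varrho$ be real-valued functions of class $\mathcal C^{1,1}(\mathbb C)$, and let $n$ be a positive integer. Assume that 1. $L^2_{\widehat\phi}$ contains the constants, and $\alpha,\beta\ge 0$ are numbers such that $\widehat\phi\le\phi+\alpha$ on $\mathbb C$ and $\phi\le\beta+\widehat\phi$ on $\Sigma$; 2. $A^2_{\widehat\phi}\subset A^2_{\phi,n}$; 3. $\widehat\phi+\varrho$ is strictly subharmonic on $\mathbb C$; 4. $\varrho$ is locally constant on $\mathbb C\setminus\Sigma$; 5. $0<\kappa<1$ is a number such that $$\frac{|\bar\partial\varrho|^2}{\Delta\widehat\phi+\Delta\varrho}\le\frac{\kappa^2}{e^{\alpha+\beta}}\quad\text{a.e. on }\Sigma.$$ Let $f\in\mathcal C_0^\infty(\mathbb C)$ satisfy $\operatorname{supp}f\subset\Sigma$. Then the $L^2_{\phi,n}$-minimal solution $u_*$ to $\bar\partial u=f$ exists, is unique up to null sets, and satisfies $$\int_{\mathbb C}|u_*|^2e^{\varrho-\phi}\,dA\le\frac{e^{\alpha+\beta}}{(1-\kappa)^2}\int_{\mathbb C}|f|^2\,\frac{e^{\varrho-\phi}}{\Delta\widehat\phi+\Delta\varrho}\,dA,$$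 where the right-hand side may be $+\infty$. -/

import Mathlib

open MeasureTheory
open scoped ContDiff

noncomputable section

/-- The class `C^{1,1}(ℂ)`: continuously differentiable functions whose (real) derivative is
locally Lipschitz. -/
def IsC11 (g : ℂ → ℝ) : Prop :=
  ContDiff ℝ 1 g ∧ LocallyLipschitz (fderiv ℝ g)

/-- The Wirtinger derivative `∂̄g = (∂g/∂x + i ∂g/∂y) / 2`. -/
def dbar (g : ℂ → ℂ) (z : ℂ) : ℂ :=
  (1 / 2 : ℂ) * (fderiv ℝ g z 1 + Complex.I * fderiv ℝ g z Complex.I)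

/-- The normalized Laplacian `Δ = ∂∂̄ = (∂²/∂x² + ∂²/∂y²) / 4`, taken pointwise; for a function of
class `C^{1,1}` the second derivatives exist almost everywhere. -/
def normLaplacian (g : ℂ → ℝ) (z : ℂ) : ℝ :=
  (1 / 4 : ℝ) * Laplacian.laplacian g z

/-- A function of class `C^{1,1}` is strictly subharmonic if its Laplacian is positive almost
everywhere. -/
def IsStrictlySubharmonic (g : ℂ → ℝ) : Prop :=
  ∀ᵐ z : ℂ, 0 < normLaplacian g z

/-- The normalized area measure `dA = dx dy / π`. -/
def areaMeasure : Measure ℂ :=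
  ENNReal.ofReal Real.pi⁻¹ • (volume : Measure ℂ)

/-- The measure `dμ_φ = e^{-φ} dA`. -/
def weightMeasure (φ : ℂ → ℝ) : Measure ℂ :=
  areaMeasure.withDensity (fun z => ENNReal.ofReal (Real.exp (-φ z)))

/-- The space `L²_φ` (as a set of functions). -/
def L2 (φ : ℂ → ℝ) : Set (ℂ → ℂ) :=
  {u | MemLp u 2 (weightMeasure φ)}

/-- The Bergman space `A²_φ` of entire functions in `L²_φ`. -/
def A2 (φ : ℂ → ℝ) : Set (ℂ → ℂ) :=
  {u | u ∈ L2 φ ∧ Differentiable ℂ u}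

/-- The space `L²_{φ,n}` of those `u ∈ L²_φ` with `u(z) = O(|z|^{n-1})` as `z → ∞`. Elements of
`L²_φ` being determined up to null sets only, so is the growth condition. -/
def L2Trunc (φ : ℂ → ℝ) (n : ℕ) : Set (ℂ → ℂ) :=
  {u | u ∈ L2 φ ∧ ∃ C R : ℝ, ∀ᵐ z : ℂ, R ≤ ‖z‖ → ‖u z‖ ≤ C * ‖z‖ ^ (n - 1)}

/-- The space `A²_{φ,n} = L²_{φ,n} ∩ A²_φ`. -/
def A2Trunc (φ : ℂ → ℝ) (n : ℕ) : Set (ℂ → ℂ) :=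
  L2Trunc φ n ∩ A2 φ

/-- `u` is a solution of `∂̄u = f` in the sense of distributions. -/
def IsDbarSolution (u f : ℂ → ℂ) : Prop :=
  LocallyIntegrable u ∧
    ∀ χ : ℂ → ℂ, ContDiff ℝ ∞ χ → HasCompactSupport χ →
      ∫ z, u z * dbar χ z = -∫ z, f z * χ z

/-- `u` is an `L²_{φ,n}`-minimal solution of `∂̄u = f`: a solution in `L²_{φ,n}` whose `L²_φ`-norm
is minimal among all solutions in `L²_{φ,n}`. -/
def IsMinimalSolution (φ : ℂ → ℝ) (n : ℕ) (f u : ℂ → ℂ) : Prop :=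
  (u ∈ L2Trunc φ n ∧ IsDbarSolution u f) ∧
    ∀ v ∈ L2Trunc φ n, IsDbarSolution v f →
      eLpNorm u 2 (weightMeasure φ) ≤ eLpNorm v 2 (weightMeasure φ)

end

/-! The estimate comes from comparing two weights by orthogonality, followed by absorption of an
error term.

By Weyl's lemma, two solutions in $L^2_{\phi,n}$ differ by an element of $A^2_{\phi,n}$, a space of
polynomials of degree at most $n-1$. The solutions thus form an affine copy of a finite-dimensional
space. It is nonempty because the Cauchy transform of $f$ is bounded and constants lie in
$L^2_{\widehat\phi}\subset L^2_\phi$. Orthogonal projection gives existence and uniqueness of $u_*$,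
although $L^2_{\phi,n}$ itself need not be closed, and shows that $u_*\perp A^2_{\phi,n}$ in
$L^2_\phi$.

Put $w=u_*e^{\varrho}$. The factor $e^{\varrho}$ is cancelled by the weight $e^{-(\phi+\varrho)}$,
so $w\perp A^2_{\phi,n}$ in $L^2_{\phi+\varrho}$. Hence $w$ has least norm there among the
$L^2_{\phi,n}$ solutions of $\bar\partial w=F$, where $F=(f+u_*\bar\partial\varrho)e^{\varrho}$
vanishes a.e. off $\Sigma$. Hörmander's theorem for the strictly subharmonic weight
$\widehat\phi+\varrho$ supplies a competitor $v$: it is a bounded Cauchy transform plus an entire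
function in $A^2_{\widehat\phi}$, so assumption 2 puts it in $L^2_{\phi,n}$. Therefore
$$\int|u_*|^2e^{\varrho-\phi}\,dA=\|w\|^2_{\phi+\varrho}\le\|v\|^2_{\phi+\varrho}\le
e^{\alpha}\int|F|^2\frac{e^{-(\widehat\phi+\varrho)}}{\Delta\widehat\phi+\Delta\varrho}\,dA.$$ On
$\Sigma$, $e^{-\widehat\phi}\le e^{\beta}e^{-\phi}$; splitting $|f+u_*\bar\partial\varrho|^2$ with
weights $1-\kappa$ and $\kappa$ and using assumption 5, the $u_*$ term is at most $\kappa$ times the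
left side, which is finite because $\varrho$ is bounded. Absorbing it gives the second factor
$1-\kappa$.

The analytic input is `exists_weighted_dbar_solution` (Hörmander), resting on
`IsC11.integral_normLaplacian_le`, and `exists_entire_ae_eq_of_integral_dbar_eq_zero` (Weyl). The
comparison is `IsMinimalSolution.lintegral_le_of_hormander`. -/

/-! ### The Wirtinger operators -/

/-- The Wirtinger derivative `∂g = (∂g/∂x - i ∂g/∂y) / 2`. -/
noncomputable def wirtingerDel (g : ℂ → ℂ) (z : ℂ) : ℂ :=
  (1 / 2 : ℂ) * (fderiv ℝ g z 1 - Complex.I * fderiv ℝ g z Complex.I)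

theorem dbar_mul {f g : ℂ → ℂ} {z : ℂ} (hf : DifferentiableAt ℝ f z)
    (hg : DifferentiableAt ℝ g z) :
    dbar (fun w => f w * g w) z = dbar f z * g z + f z * dbar g z := by
  simp only [dbar, fderiv_fun_mul hf hg]
  simp
  ring

theorem dbar_add {f g : ℂ → ℂ} {z : ℂ} (hf : DifferentiableAt ℝ f z)
    (hg : DifferentiableAt ℝ g z) :
    dbar (fun w => f w + g w) z = dbar f z + dbar g z := by
  simp only [dbar, fderiv_fun_add hf hg]
  simp
  ring

theorem dbar_const_mul {f : ℂ → ℂ} {z : ℂ} (hf : DifferentiableAt ℝ f z) (c : ℂ) :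
    dbar (fun w => c * f w) z = c * dbar f z := by
  simp only [dbar, fderiv_const_mul hf]
  simp
  ring

theorem wirtingerDel_mul {f g : ℂ → ℂ} {z : ℂ} (hf : DifferentiableAt ℝ f z)
    (hg : DifferentiableAt ℝ g z) :
    wirtingerDel (fun w => f w * g w) z = wirtingerDel f z * g z + f z * wirtingerDel g z := by
  simp only [wirtingerDel, fderiv_fun_mul hf hg]
  simp
  ring

theorem fderiv_conj_comp {f : ℂ → ℂ} {z : ℂ} (hf : DifferentiableAt ℝ f z) (v : ℂ) :
    fderiv ℝ (fun w => (starRingEnd ℂ) (f w)) z v = (starRingEnd ℂ) (fderiv ℝ f z v) := by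
  have := (Complex.conjCLE.toContinuousLinearMap.hasFDerivAt.comp z hf.hasFDerivAt).fderiv
  have h2 : (fun w => (starRingEnd ℂ) (f w)) = (Complex.conjCLE.toContinuousLinearMap ∘ f) := by
    ext; simp
  rw [h2, this]
  simp

theorem dbar_conj {f : ℂ → ℂ} {z : ℂ} (hf : DifferentiableAt ℝ f z) :
    dbar (fun w => (starRingEnd ℂ) (f w)) z = (starRingEnd ℂ) (wirtingerDel f z) := by
  simp only [dbar, wirtingerDel, fderiv_conj_comp hf]
  simp [map_ofNat]

theorem wirtingerDel_conj {f : ℂ → ℂ} {z : ℂ} (hf : DifferentiableAt ℝ f z) :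
    wirtingerDel (fun w => (starRingEnd ℂ) (f w)) z = (starRingEnd ℂ) (dbar f z) := by
  simp only [dbar, wirtingerDel, fderiv_conj_comp hf]
  simp [sub_eq_add_neg, map_ofNat]

theorem dbar_eq_zero_of_differentiableAt {f : ℂ → ℂ} {z : ℂ} (hf : DifferentiableAt ℂ f z) :
    dbar f z = 0 := by
  have h := (differentiableAt_complex_iff_differentiableAt_real.1 hf).2
  simp only [dbar, h, smul_eq_mul, ← mul_assoc, Complex.I_mul_I]
  ring

theorem differentiableAt_of_dbar_eq_zero {f : ℂ → ℂ} {z : ℂ} (hf : DifferentiableAt ℝ f z)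
    (h : dbar f z = 0) : DifferentiableAt ℂ f z := by
  refine differentiableAt_complex_iff_differentiableAt_real.2 ⟨hf, ?_⟩
  have h1 : fderiv ℝ f z 1 + Complex.I * fderiv ℝ f z Complex.I = 0 := by
    simpa [dbar] using h
  have h2 : Complex.I * (fderiv ℝ f z 1 + Complex.I * fderiv ℝ f z Complex.I) = 0 := by
    rw [h1, mul_zero]
  rw [mul_add, ← mul_assoc, Complex.I_mul_I] at h2
  rw [smul_eq_mul]
  linear_combination -h2

theorem ContDiff.dbar_succ {n m : WithTop ℕ∞} {f : ℂ → ℂ} (hf : ContDiff ℝ n f) (h : m + 1 ≤ n) :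
    ContDiff ℝ m (dbar f) := by
  have h1 : ∀ v : ℂ, ContDiff ℝ m (fun z => fderiv ℝ f z v) := fun v =>
    (hf.fderiv_right h).clm_apply contDiff_const
  exact contDiff_const.mul ((h1 1).add (contDiff_const.mul (h1 _)))

theorem ContDiff.wirtingerDel_succ {n m : WithTop ℕ∞} {f : ℂ → ℂ} (hf : ContDiff ℝ n f)
    (h : m + 1 ≤ n) : ContDiff ℝ m (wirtingerDel f) := by
  have h1 : ∀ v : ℂ, ContDiff ℝ m (fun z => fderiv ℝ f z v) := fun v =>
    (hf.fderiv_right h).clm_apply contDiff_const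
  exact contDiff_const.mul ((h1 1).sub (contDiff_const.mul (h1 _)))

theorem ContDiff.continuous_dbar {f : ℂ → ℂ} (hf : ContDiff ℝ 1 f) : Continuous (dbar f) :=
  (hf.dbar_succ (m := 0) (by simp)).continuous

theorem support_dbar_subset (f : ℂ → ℂ) : Function.support (dbar f) ⊆ tsupport f := by
  intro z hz
  by_contra h
  have : fderiv ℝ f z = 0 := by
    by_contra h'
    exact h (support_fderiv_subset ℝ h')
  simp [dbar, this] at hz

theorem HasCompactSupport.dbar {f : ℂ → ℂ} (hf : HasCompactSupport f) :
    HasCompactSupport (dbar f) :=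
  hf.mono' (support_dbar_subset f)

/-! ### Integration of derivatives of Lipschitz functions -/

/-- Compactness gives a uniform constant on the closed 1-thickening of the support. If one point is
in the support and the other outside the thickening, the distance is at least 1 and one value is
zero, so the sup bound serves as a Lipschitz constant. -/
theorem LocallyLipschitz.exists_lipschitzWith_of_hasCompactSupport {E F : Type*}
    [NormedAddCommGroup E] [ProperSpace E] [NormedAddCommGroup F] {f : E → F}
    (hf : LocallyLipschitz f) (hc : HasCompactSupport f) : ∃ C, LipschitzWith C f := by
  obtain ⟨M, hM⟩ := hc.exists_bound_of_continuous hf.continuous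
  have hK : IsCompact (Metric.cthickening 1 (tsupport f)) := IsCompact.cthickening hc
  obtain ⟨C, hC⟩ := (hf.locallyLipschitzOn (s := Metric.cthickening 1 (tsupport f))
    ).exists_lipschitzOnWith_of_compact hK
  have key : ∀ x y, x ∈ tsupport f → ‖f x - f y‖ ≤ (C + M.toNNReal : NNReal) * ‖x - y‖ := by
    intro x y hx
    have hx' : x ∈ Metric.cthickening 1 (tsupport f) := Metric.self_subset_cthickening _ hx
    have hC0 := mul_nonneg C.coe_nonneg (norm_nonneg (x - y))
    have hM0 := mul_nonneg M.toNNReal.coe_nonneg (norm_nonneg (x - y))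
    push_cast
    rw [add_mul]
    by_cases hy : y ∈ Metric.cthickening 1 (tsupport f)
    · have := hC.norm_sub_le hx' hy
      linarith
    · have h1 : 1 ≤ ‖x - y‖ := by
        by_contra h
        push Not at h
        refine hy (Metric.mem_cthickening_of_dist_le y x 1 _ hx ?_)
        rw [dist_comm, dist_eq_norm]; exact h.le
      have h2 : f y = 0 := by
        by_contra h
        exact hy (Metric.self_subset_cthickening _ (subset_tsupport _ h))
      rw [h2, sub_zero]
      have h3 : M ≤ M.toNNReal := Real.le_coe_toNNReal M
      have h4 : (M.toNNReal : ℝ) ≤ M.toNNReal * ‖x - y‖ :=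
        le_mul_of_one_le_right M.toNNReal.coe_nonneg h1
      linarith [hM x]
  refine ⟨C + M.toNNReal, LipschitzWith.of_dist_le_mul fun x y => ?_⟩
  rw [dist_eq_norm, dist_eq_norm]
  by_cases hx : x ∈ tsupport f
  · exact key x y hx
  by_cases hy : y ∈ tsupport f
  · rw [norm_sub_rev, norm_sub_rev x y]; exact key y x hy
  · rw [image_eq_zero_of_notMem_tsupport hx, image_eq_zero_of_notMem_tsupport hy]
    simp only [sub_self, norm_zero]
    positivity

theorem LocallyLipschitz.mul_complex {α : Type*} [PseudoEMetricSpace α] {f g : α → ℂ}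
    (hf : LocallyLipschitz f) (hg : LocallyLipschitz g) :
    LocallyLipschitz (fun x => f x * g x) := by
  have h : LocallyLipschitz (fun p : ℂ × ℂ => p.1 * p.2) :=
    (contDiff_fst.mul contDiff_snd : ContDiff ℝ 1 (fun p : ℂ × ℂ => p.1 * p.2)).locallyLipschitz
  exact h.comp (hf.prodMk hg)

theorem LipschitzWith.integrable_fderiv_apply {E F : Type*} [NormedAddCommGroup E]
    [NormedSpace ℝ E] [FiniteDimensional ℝ E] [MeasurableSpace E] [BorelSpace E]
    [NormedAddCommGroup F] [NormedSpace ℝ F] [FiniteDimensional ℝ F]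
    [MeasurableSpace F] [BorelSpace F] {μ : Measure E} [IsFiniteMeasureOnCompacts μ]
    {C : NNReal} {f : E → F} (hf : LipschitzWith C f) (hc : HasCompactSupport f) (v : E) :
    Integrable (fun z => fderiv ℝ f z v) μ := by
  have : ProperSpace F := FiniteDimensional.proper ℝ F
  have : SecondCountableTopology F := inferInstance
  have hm : AEStronglyMeasurable (fun z => fderiv ℝ f z v) μ :=
    (measurable_fderiv_apply_const ℝ f v).aestronglyMeasurable
  have hs : Function.support (fun z => fderiv ℝ f z v) ⊆ tsupport f := by
    intro z hz
    by_contra h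
    have : fderiv ℝ f z = 0 := by
      by_contra h'
      exact h (support_fderiv_subset ℝ h')
    simp [this] at hz
  rw [← integrableOn_iff_integrable_of_support_subset hs]
  refine Measure.integrableOn_of_bounded (M := C * ‖v‖) hc.measure_lt_top.ne hm ?_
  refine Filter.Eventually.of_forall fun z => ?_
  exact ((fderiv ℝ f z).le_opNorm v).trans (by gcongr; exact norm_fderiv_le_of_lipschitz ℝ hf)

/-- Integration by parts for Lipschitz functions against the constant 1; by Rademacher the line
derivative is the Fréchet derivative a.e. -/
theorem LipschitzWith.integral_fderiv_apply_eq_zero_real {E : Type*} [NormedAddCommGroup E]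
    [NormedSpace ℝ E] [FiniteDimensional ℝ E] [MeasurableSpace E] [BorelSpace E]
    {μ : Measure E} [μ.IsAddHaarMeasure] {C : NNReal} {f : E → ℝ} (hf : LipschitzWith C f)
    (hc : HasCompactSupport f) (v : E) : ∫ z, fderiv ℝ f z v ∂μ = 0 := by
  have h := (LipschitzWith.const (α := E) (1 : ℝ)).integral_lineDeriv_mul_eq (μ := μ) hf hc (-v)
  have h0 : ∀ x : E, lineDeriv ℝ (fun _ : E => (1 : ℝ)) x (-v) = 0 := fun x => by
    simp [lineDeriv]
  simp only [h0, zero_mul, integral_zero, neg_neg, mul_one] at h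
  rw [h]
  refine integral_congr_ae ?_
  filter_upwards [hf.ae_differentiableAt (μ := μ)] with z hz
  exact hz.lineDeriv_eq_fderiv.symm

theorem LipschitzWith.integral_fderiv_apply_eq_zero {E : Type*} [NormedAddCommGroup E]
    [NormedSpace ℝ E] [FiniteDimensional ℝ E] [MeasurableSpace E] [BorelSpace E]
    {μ : Measure E} [μ.IsAddHaarMeasure] {C : NNReal} {f : E → ℂ} (hf : LipschitzWith C f)
    (hc : HasCompactSupport f) (v : E) : ∫ z, fderiv ℝ f z v ∂μ = 0 := by
  have hint := hf.integrable_fderiv_apply (μ := μ) hc v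
  have key : ∀ L : ℂ →L[ℝ] ℝ, L (∫ z, fderiv ℝ f z v ∂μ) = 0 := by
    intro L
    rw [← L.integral_comp_comm hint,
      ← (L.lipschitz.comp hf).integral_fderiv_apply_eq_zero_real (μ := μ)
        (hc.comp_left (map_zero L)) v]
    refine integral_congr_ae ?_
    filter_upwards [hf.ae_differentiableAt (μ := μ)] with z hz
    rw [fderiv_comp z L.differentiableAt hz]
    simp
  apply Complex.ext
  · exact key Complex.reCLM
  · exact key Complex.imCLM

/-- Stokes' theorem at Lipschitz regularity, which is all that remains for expressions containing
the gradient of a $C^{1,1}$ weight. -/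
theorem LocallyLipschitz.integral_dbar_eq_zero {f : ℂ → ℂ} (hf : LocallyLipschitz f)
    (hc : HasCompactSupport f) : ∫ z, dbar f z = 0 := by
  obtain ⟨C, hC⟩ := hf.exists_lipschitzWith_of_hasCompactSupport hc
  simp only [dbar]
  rw [integral_const_mul, integral_add (hC.integrable_fderiv_apply hc _)
    ((hC.integrable_fderiv_apply hc _).const_mul _), integral_const_mul,
    hC.integral_fderiv_apply_eq_zero hc, hC.integral_fderiv_apply_eq_zero hc]
  simp

theorem LocallyLipschitz.integral_wirtingerDel_eq_zero {f : ℂ → ℂ} (hf : LocallyLipschitz f)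
    (hc : HasCompactSupport f) : ∫ z, wirtingerDel f z = 0 := by
  obtain ⟨C, hC⟩ := hf.exists_lipschitzWith_of_hasCompactSupport hc
  simp only [wirtingerDel]
  rw [integral_const_mul, integral_sub (hC.integrable_fderiv_apply hc _)
    ((hC.integrable_fderiv_apply hc _).const_mul _), integral_const_mul,
    hC.integral_fderiv_apply_eq_zero hc, hC.integral_fderiv_apply_eq_zero hc]
  simp

theorem LocallyLipschitz.integrable_dbar {f : ℂ → ℂ} (hf : LocallyLipschitz f)
    (hc : HasCompactSupport f) : Integrable (dbar f) := by
  obtain ⟨C, hC⟩ := hf.exists_lipschitzWith_of_hasCompactSupport hc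
  exact ((hC.integrable_fderiv_apply hc _).add
    ((hC.integrable_fderiv_apply hc _).const_mul _)).const_mul _

theorem LocallyLipschitz.integrable_wirtingerDel {f : ℂ → ℂ} (hf : LocallyLipschitz f)
    (hc : HasCompactSupport f) : Integrable (wirtingerDel f) := by
  obtain ⟨C, hC⟩ := hf.exists_lipschitzWith_of_hasCompactSupport hc
  exact ((hC.integrable_fderiv_apply hc _).sub
    ((hC.integrable_fderiv_apply hc _).const_mul _)).const_mul _

/-! ### The Cauchy transform -/

theorem fderiv_apply_eq_re_im (g : ℂ → ℂ) (z v : ℂ) :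
    fderiv ℝ g z v = v.re * fderiv ℝ g z 1 + v.im * fderiv ℝ g z Complex.I := by
  have h : v = v.re • (1 : ℂ) + v.im • Complex.I := by
    simp [Complex.re_add_im]
  conv_lhs => rw [h, map_add, map_smul, map_smul]
  simp

/-- The unit vector with argument `θ`. -/
noncomputable def unitVector (θ : ℝ) : ℂ := (Real.cos θ : ℂ) + (Real.sin θ : ℂ) * Complex.I

theorem unitVector_re (θ : ℝ) : (unitVector θ).re = Real.cos θ := by
  simp [unitVector, -Complex.ofReal_cos, -Complex.ofReal_sin]

theorem unitVector_im (θ : ℝ) : (unitVector θ).im = Real.sin θ := by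
  simp [unitVector, -Complex.ofReal_cos, -Complex.ofReal_sin]

theorem unitVector_mul_conj (θ : ℝ) :
    unitVector θ * ((Real.cos θ : ℂ) - (Real.sin θ : ℂ) * Complex.I) = 1 := by
  have h : (Real.cos θ : ℂ) ^ 2 + (Real.sin θ : ℂ) ^ 2 = 1 := by
    exact_mod_cast Real.cos_sq_add_sin_sq θ
  rw [unitVector]
  linear_combination h - (Real.sin θ : ℂ) ^ 2 * Complex.I_sq

theorem norm_unitVector (θ : ℝ) : ‖unitVector θ‖ = 1 := by
  rw [Complex.norm_def, Complex.normSq_apply, unitVector_re, unitVector_im, Real.sqrt_eq_one]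
  nlinarith [Real.cos_sq_add_sin_sq θ]

theorem continuous_unitVector : Continuous unitVector := by
  unfold unitVector; fun_prop

theorem hasDerivAt_unitVector (θ : ℝ) :
    HasDerivAt unitVector (Complex.I * unitVector θ) θ := by
  have h1 := (Real.hasDerivAt_cos θ).ofReal_comp
  have h2 := (Real.hasDerivAt_sin θ).ofReal_comp.mul_const Complex.I
  have h3 := h1.add h2
  convert! h3 using 1
  rw [unitVector]
  push_cast
  linear_combination (Complex.sin θ) * Complex.I_sq

/-- The polar form $\bar\partial=\frac{e^{i\theta}}2(\partial_r+\frac ir\partial_\theta)$: the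
Jacobian $r$ cancels the singularity of $1/z$, leaving a radial and a tangential directional
derivative. -/
theorem dbar_div_polar (χ : ℂ → ℂ) {r : ℝ} (hr : 0 < r) (θ : ℝ) :
    r • (dbar χ (r * unitVector θ) / (r * unitVector θ)) =
      (1 / 2 : ℂ) * (fderiv ℝ χ (r * unitVector θ) (unitVector θ) +
        Complex.I * fderiv ℝ χ (r * unitVector θ) (Complex.I * unitVector θ)) := by
  have hr' : (r : ℂ) ≠ 0 := by exact_mod_cast hr.ne'
  have hu : unitVector θ ≠ 0 := left_ne_zero_of_mul_eq_one (unitVector_mul_conj θ)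
  have h1 := unitVector_mul_conj θ
  rw [fderiv_apply_eq_re_im χ _ (unitVector θ), fderiv_apply_eq_re_im χ _ (Complex.I * _)]
  simp only [Complex.mul_re, Complex.mul_im, Complex.I_re, Complex.I_im, unitVector_re,
    unitVector_im, dbar, Complex.real_smul]
  generalize fderiv ℝ χ (r * unitVector θ) 1 = a
  generalize fderiv ℝ χ (r * unitVector θ) Complex.I = b
  have h2 : (r : ℂ) * (1 / 2 * (a + Complex.I * b) / (r * unitVector θ)) =
      1 / 2 * (a + Complex.I * b) * ((Real.cos θ : ℂ) - (Real.sin θ : ℂ) * Complex.I) := by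
    field_simp
    linear_combination (-(a + Complex.I * b)) * h1
  rw [h2]
  push_cast
  linear_combination (-(1 / 2) * b * Complex.sin θ) * Complex.I_sq

theorem integrableOn_polar_target {E : Type*} [NormedAddCommGroup E] {g : ℝ × ℝ → E}
    (hg : Continuous g) {R : ℝ} (hR : ∀ r θ, R < r → g (r, θ) = 0) :
    IntegrableOn g (Set.Ioi 0 ×ˢ Set.Ioo (-Real.pi) Real.pi) := by
  have h : IntegrableOn g (Set.Icc 0 R ×ˢ Set.Icc (-Real.pi) Real.pi) :=
    hg.continuousOn.integrableOn_compact (isCompact_Icc.prod isCompact_Icc)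
  refine h.of_forall_sdiff_eq_zero (measurableSet_Ioi.prod measurableSet_Ioo) ?_
  rintro ⟨r, θ⟩ ⟨⟨h1, h2⟩, h3⟩
  apply hR
  by_contra h4
  push Not at h4
  exact h3 ⟨⟨(Set.mem_Ioi.1 h1).le, h4⟩, Set.Ioo_subset_Icc_self h2⟩

/-- Cauchy–Pompeiu at the origin. The radial derivative integrates to $-\chi(0)$ on each ray; the
tangential one integrates to zero over each circle by periodicity. -/
theorem integral_dbar_div_self {χ : ℂ → ℂ} (hχ : ContDiff ℝ 1 χ) (hc : HasCompactSupport χ) :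
    ∫ z, dbar χ z / z = -(Real.pi * χ 0) := by
  obtain ⟨R, hR0, hR⟩ : ∃ R : ℝ, 0 < R ∧ ∀ z, R < ‖z‖ → z ∉ tsupport χ := by
    obtain ⟨R, hR⟩ := hc.isCompact.isBounded.exists_norm_le
    refine ⟨max R 1, by positivity, fun z hz hz' => ?_⟩
    exact absurd (hR z hz') (not_le.2 ((le_max_left _ _).trans_lt hz))
  have hnorm : ∀ (r θ : ℝ), R < |r| → ((r : ℂ) * unitVector θ) ∉ tsupport χ := by
    intro r θ h
    apply hR
    rw [norm_mul, norm_unitVector, mul_one, Complex.norm_real, Real.norm_eq_abs]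
    exact h
  have hD0 : ∀ (r θ : ℝ), R < r → fderiv ℝ χ (r * unitVector θ) = 0 := by
    intro r θ h
    by_contra h'
    exact hnorm r θ (h.trans_le (le_abs_self r)) (support_fderiv_subset ℝ h')
  have hcD : Continuous (fderiv ℝ χ) := hχ.continuous_fderiv one_ne_zero
  have hcu := continuous_unitVector
  set A : ℝ × ℝ → ℂ := fun p => fderiv ℝ χ (p.1 * unitVector p.2) (unitVector p.2) with hA
  set B : ℝ × ℝ → ℂ := fun p => fderiv ℝ χ (p.1 * unitVector p.2) (Complex.I * unitVector p.2)
    with hB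
  have hAc : Continuous A := by
    have h1 : Continuous (fun p : ℝ × ℝ => (p.1 : ℂ) * unitVector p.2) := by fun_prop
    exact (hcD.comp h1).clm_apply (hcu.comp continuous_snd)
  have hBc : Continuous B := by
    have h1 : Continuous (fun p : ℝ × ℝ => (p.1 : ℂ) * unitVector p.2) := by fun_prop
    exact (hcD.comp h1).clm_apply (continuous_const.mul (hcu.comp continuous_snd))
  have hAi := integrableOn_polar_target hAc (R := R) (fun r θ h => by simp [hA, hD0 r θ h])
  have hBi := integrableOn_polar_target hBc (R := R) (fun r θ h => by simp [hB, hD0 r θ h])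
  have htarget : polarCoord.target = Set.Ioi 0 ×ˢ Set.Ioo (-Real.pi) Real.pi := rfl
  rw [← Complex.integral_comp_polarCoord_symm, htarget]
  have hstep : ∫ p in Set.Ioi (0 : ℝ) ×ˢ Set.Ioo (-Real.pi) Real.pi,
      p.1 • (dbar χ (Complex.polarCoord.symm p) / Complex.polarCoord.symm p) =
      ∫ p in Set.Ioi (0 : ℝ) ×ˢ Set.Ioo (-Real.pi) Real.pi,
        (1 / 2 : ℂ) * (A p + Complex.I * B p) := by
    refine setIntegral_congr_fun (measurableSet_Ioi.prod measurableSet_Ioo) ?_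
    rintro ⟨r, θ⟩ ⟨hr, -⟩
    have := dbar_div_polar χ hr θ
    simpa only [Complex.polarCoord_symm_apply, unitVector, hA, hB] using this
  rw [hstep, integral_const_mul, integral_add hAi (hBi.const_mul _), integral_const_mul]
  have hAval : ∫ p in Set.Ioi (0 : ℝ) ×ˢ Set.Ioo (-Real.pi) Real.pi, A p
      = -(2 * Real.pi * χ 0) := by
    rw [Measure.volume_eq_prod, ← Measure.prod_restrict, integral_prod_symm]
    · have hin : ∀ θ : ℝ, ∫ r in Set.Ioi (0 : ℝ), A (r, θ) = -χ 0 := by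
        intro θ
        have hcd : ContDiff ℝ 1 (fun r : ℝ => χ (r * unitVector θ)) :=
          hχ.comp (Complex.ofRealCLM.contDiff.mul contDiff_const)
        have hcs : HasCompactSupport (fun r : ℝ => χ (r * unitVector θ)) := by
          refine HasCompactSupport.intro (isCompact_Icc (a := -R) (b := R)) fun r hr => ?_
          apply image_eq_zero_of_notMem_tsupport
          apply hnorm
          by_contra h
          exact hr (abs_le.1 (not_lt.1 h))
        have := hcs.integral_Ioi_deriv_eq hcd 0
        simp only [Complex.ofReal_zero, zero_mul] at this
        rw [← this]
        refine integral_congr_ae (Filter.Eventually.of_forall fun r => ?_)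
        have h1 : HasDerivAt (fun r : ℝ => (r : ℂ) * unitVector θ) (unitVector θ) r := by
          simpa using (hasDerivAt_id r).ofReal_comp.mul_const (unitVector θ)
        exact (((hχ.differentiable one_ne_zero _).hasFDerivAt.comp_hasDerivAt r h1).deriv).symm
      simp only [hin]
      rw [setIntegral_const]
      simp only [measureReal_def, Real.volume_Ioo, sub_neg_eq_add]
      rw [ENNReal.toReal_ofReal (by positivity), Complex.real_smul]
      push_cast; ring
    · rw [Measure.prod_restrict]; exact hAi
  have hBval : ∫ p in Set.Ioi (0 : ℝ) ×ˢ Set.Ioo (-Real.pi) Real.pi, B p = 0 := by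
    rw [Measure.volume_eq_prod, setIntegral_prod _ hBi]
    have hin : ∀ r ∈ Set.Ioi (0 : ℝ), ∫ θ in Set.Ioo (-Real.pi) Real.pi, B (r, θ) = 0 := by
      intro r hr
      have hr' : (r : ℂ) ≠ 0 := by exact_mod_cast (Set.mem_Ioi.1 hr).ne'
      -- On the circle of radius $r$, $r^{-1}\chi(re^{i\theta})$ is a $2\pi$-periodic primitive of
      -- the tangential derivative.
      have hderiv : ∀ θ ∈ Set.uIcc (-Real.pi) Real.pi,
          HasDerivAt (fun θ : ℝ => (r : ℂ)⁻¹ * χ (r * unitVector θ)) (B (r, θ)) θ := by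
        intro θ _
        have h1 : HasDerivAt (fun θ : ℝ => (r : ℂ) * unitVector θ)
            (r • (Complex.I * unitVector θ)) θ := by
          simpa using (hasDerivAt_unitVector θ).const_mul (r : ℂ)
        have h2 := ((hχ.differentiable one_ne_zero _).hasFDerivAt.comp_hasDerivAt θ h1).const_mul
          ((r : ℂ)⁻¹)
        convert! h2 using 1
        rw [map_smul, Complex.real_smul, ← mul_assoc, inv_mul_cancel₀ hr', one_mul]
      have hpi : -Real.pi ≤ Real.pi := by linarith [Real.pi_pos]
      rw [← integral_Ioc_eq_integral_Ioo, ← intervalIntegral.integral_of_le hpi,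
        intervalIntegral.integral_eq_sub_of_hasDerivAt hderiv]
      · simp [unitVector]
      · apply Continuous.intervalIntegrable
        exact hBc.comp (by fun_prop)
    rw [setIntegral_congr_fun measurableSet_Ioi hin]
    simp
  rw [hAval, hBval]
  ring

theorem integral_dbar_div_sub {χ : ℂ → ℂ} (hχ : ContDiff ℝ 1 χ) (hc : HasCompactSupport χ)
    (w : ℂ) : ∫ z, dbar χ z / (z - w) = -(Real.pi * χ w) := by
  have h := integral_dbar_div_self (χ := fun z => χ (z + w))
    (hχ.comp (contDiff_id.add contDiff_const))
    (hc.comp_homeomorph (Homeomorph.addRight w))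
  rw [zero_add] at h
  rw [← h, ← integral_sub_right_eq_self (fun z => dbar (fun z => χ (z + w)) z / z) w]
  congr 1
  ext z
  simp [dbar, fderiv_comp_add_right]

/-- The Cauchy kernel `1 / |z|` cut off to the unit ball. -/
theorem integrable_indicator_norm_inv :
    Integrable ((Metric.ball (0 : ℂ) 1).indicator fun z => ‖z‖⁻¹) := by
  rw [integrable_indicator_iff measurableSet_ball]
  have h : LocallyIntegrable (fun z : ℂ => ‖z‖⁻¹) := by
    refine locallyIntegrable_of_norm_le_rpow (C := 1) (α := 1) (by simp) (by simp) ?_ ?_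
    · refine Filter.Eventually.of_forall fun z => ?_
      rw [Real.rpow_neg_one]; simp
    · exact (measurable_norm.inv).aestronglyMeasurable
  exact (h.integrableOn_isCompact (isCompact_closedBall 0 1)).mono_set Metric.ball_subset_closedBall

/-- The Cauchy transform of `F`. -/
noncomputable def cauchyTransform (F : ℂ → ℂ) (z : ℂ) : ℂ :=
  (Real.pi : ℂ)⁻¹ * ∫ w, F w / (z - w)

section CauchyTransform

variable {F : ℂ → ℂ} {M R : ℝ}

/-- The kernel is integrable for $|z-w|<1$ and at most 1 elsewhere. The near term depends only on
$z-w$ and the far term only on $w$, so the integral of the bound does not depend on $z$. -/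
theorem norm_div_sub_le (hM : ∀ z, ‖F z‖ ≤ M) (hR : ∀ z, R < ‖z‖ → F z = 0) (z w : ℂ) :
    ‖F w / (z - w)‖ ≤ M * (Metric.ball (0 : ℂ) 1).indicator (fun z => ‖z‖⁻¹) (z - w)
      + (Metric.closedBall (0 : ℂ) R).indicator (fun _ => M) w := by
  have hM0 : 0 ≤ M := (norm_nonneg _).trans (hM 0)
  rw [norm_div]
  by_cases hw : w ∈ Metric.closedBall (0 : ℂ) R
  · rw [Set.indicator_of_mem hw]
    by_cases hz : z - w ∈ Metric.ball (0 : ℂ) 1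
    · rw [Set.indicator_of_mem hz, div_eq_mul_inv]
      have := mul_le_mul_of_nonneg_right (hM w) (inv_nonneg.2 (norm_nonneg (z - w)))
      linarith
    · rw [Set.indicator_of_notMem hz, mul_zero, zero_add]
      have h1 : 1 ≤ ‖z - w‖ := by simpa using hz
      exact (div_le_self (norm_nonneg _) h1).trans (hM w)
  · have h1 : R < ‖w‖ := by simpa using hw
    rw [hR w h1, norm_zero, zero_div]
    exact add_nonneg (mul_nonneg hM0 (Set.indicator_nonneg (fun _ _ => by positivity) _))
      (Set.indicator_nonneg (fun _ _ => hM0) _)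

theorem integrable_cauchy_bound (M R : ℝ) (z : ℂ) :
    Integrable (fun w : ℂ =>
      M * (Metric.ball (0 : ℂ) 1).indicator (fun z => ‖z‖⁻¹) (z - w)
      + (Metric.closedBall (0 : ℂ) R).indicator (fun _ => M) w) := by
  refine ((integrable_indicator_norm_inv.comp_sub_left z).const_mul M).add ?_
  rw [integrable_indicator_iff measurableSet_closedBall]
  exact integrableOn_const (by exact (isCompact_closedBall (0 : ℂ) R).measure_lt_top.ne)

theorem integrable_div_sub (hF : StronglyMeasurable F) (hM : ∀ z, ‖F z‖ ≤ M)
    (hR : ∀ z, R < ‖z‖ → F z = 0) (z : ℂ) : Integrable (fun w => F w / (z - w)) := by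
  refine (integrable_cauchy_bound M R z).mono' ?_
    (Filter.Eventually.of_forall fun w => norm_div_sub_le hM hR z w)
  exact (hF.measurable.div (measurable_const.sub measurable_id)).aestronglyMeasurable

theorem integral_norm_div_sub_le (hF : StronglyMeasurable F) (hM : ∀ z, ‖F z‖ ≤ M)
    (hR : ∀ z, R < ‖z‖ → F z = 0) : ∃ C, ∀ z, ∫ w, ‖F w / (z - w)‖ ≤ C := by
  refine ⟨(∫ w : ℂ, M * (Metric.ball (0 : ℂ) 1).indicator (fun z => ‖z‖⁻¹) w) +
    ∫ w : ℂ, (Metric.closedBall (0 : ℂ) R).indicator (fun _ => M) w, fun z => ?_⟩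
  have hi : Integrable ((Metric.closedBall (0 : ℂ) R).indicator (fun _ => M)) := by
    rw [integrable_indicator_iff measurableSet_closedBall]
    exact integrableOn_const (by exact (isCompact_closedBall (0 : ℂ) R).measure_lt_top.ne)
  refine (integral_mono (integrable_div_sub hF hM hR z).norm (integrable_cauchy_bound M R z)
    (fun w => norm_div_sub_le hM hR z w)).trans ?_
  rw [integral_add ((integrable_indicator_norm_inv.comp_sub_left z).const_mul M) hi,
    integral_sub_left_eq_self (fun w : ℂ =>
      M * (Metric.ball (0 : ℂ) 1).indicator (fun z => ‖z‖⁻¹) w) volume z]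

theorem stronglyMeasurable_cauchyTransform (hF : StronglyMeasurable F) :
    StronglyMeasurable (cauchyTransform F) := by
  refine StronglyMeasurable.const_mul ?_ _
  refine StronglyMeasurable.integral_prod_right (f := fun z w : ℂ => F w / (z - w)) ?_
  exact ((hF.measurable.comp measurable_snd).div
    (measurable_fst.sub measurable_snd)).stronglyMeasurable

theorem exists_norm_cauchyTransform_le (hF : StronglyMeasurable F) (hM : ∀ z, ‖F z‖ ≤ M)
    (hR : ∀ z, R < ‖z‖ → F z = 0) : ∃ C, ∀ z, ‖cauchyTransform F z‖ ≤ C := by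
  obtain ⟨C, hC⟩ := integral_norm_div_sub_le hF hM hR
  refine ⟨‖(Real.pi : ℂ)⁻¹‖ * C, fun z => ?_⟩
  rw [cauchyTransform, norm_mul]
  gcongr
  exact (norm_integral_le_integral_norm _).trans (hC z)

/-- The Cauchy transform solves $\bar\partial u=F$ weakly: Fubini reduces the claim to
Cauchy–Pompeiu for the test function. $C^1$ test functions suffice, which matters later when they
are multiplied by $e^{\varrho}$. -/
theorem integral_cauchyTransform_mul_dbar (hF : StronglyMeasurable F) (hM : ∀ z, ‖F z‖ ≤ M)
    (hR : ∀ z, R < ‖z‖ → F z = 0) {χ : ℂ → ℂ} (hχ : ContDiff ℝ 1 χ)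
    (hc : HasCompactSupport χ) :
    ∫ z, cauchyTransform F z * dbar χ z = -∫ z, F z * χ z := by
  obtain ⟨C, hC⟩ := integral_norm_div_sub_le hF hM hR
  have hg : Continuous (dbar χ) := hχ.continuous_dbar
  have hgi : Integrable (dbar χ) := hg.integrable_of_hasCompactSupport hc.dbar
  have hint : Integrable (Function.uncurry fun z w : ℂ => F w / (z - w) * dbar χ z)
      (volume.prod volume) := by
    have hm : AEStronglyMeasurable (Function.uncurry fun z w : ℂ => F w / (z - w) * dbar χ z)
        (volume.prod volume) :=
      (((hF.measurable.comp measurable_snd).div (measurable_fst.sub measurable_snd)).mul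
        (hg.measurable.comp measurable_fst)).aestronglyMeasurable
    rw [integrable_prod_iff hm]
    refine ⟨Filter.Eventually.of_forall fun z => ?_, ?_⟩
    · exact (integrable_div_sub hF hM hR z).mul_const (dbar χ z)
    · refine (hgi.norm.const_mul C).mono' hm.norm.integral_prod_right'
        (Filter.Eventually.of_forall fun z => ?_)
      simp only [Function.uncurry, norm_mul]
      rw [integral_mul_const, norm_mul, norm_norm,
        Real.norm_of_nonneg (integral_nonneg fun _ => norm_nonneg _)]
      gcongr
      exact hC z
  have hpi : (Real.pi : ℂ) ≠ 0 := by exact_mod_cast Real.pi_ne_zero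
  calc ∫ z, cauchyTransform F z * dbar χ z
      = (Real.pi : ℂ)⁻¹ * ∫ z, ∫ w, F w / (z - w) * dbar χ z := by
        rw [← integral_const_mul]
        congr 1; ext z
        rw [integral_mul_const, cauchyTransform, mul_assoc]
    _ = (Real.pi : ℂ)⁻¹ * ∫ w, ∫ z, F w / (z - w) * dbar χ z := by
        rw [integral_integral_swap hint]
    _ = (Real.pi : ℂ)⁻¹ * ∫ w, F w * (-(Real.pi * χ w)) := by
        congr 2; ext w
        rw [← integral_dbar_div_sub hχ hc w, ← integral_const_mul]
        congr 1; ext z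
        ring
    _ = -∫ z, F z * χ z := by
        rw [← integral_const_mul, ← integral_neg]
        congr 1; ext w
        field_simp

end CauchyTransform

/-! ### Weyl's lemma for the `∂̄` operator -/

section Weyl

open ContinuousLinearMap (mul)

/-- A smooth compactly supported convolution kernel which reproduces entire functions. -/
theorem exists_reproducing_kernel :
    ∃ ρ : ℂ → ℂ, ContDiff ℝ ∞ ρ ∧ HasCompactSupport ρ ∧
      ∀ h : ℂ → ℂ, Differentiable ℂ h → ∀ z, convolution h ρ (mul ℝ ℂ) volume z = h z := by
  let b : ContDiffBump (0 : ℂ) := ⟨1, 2, one_pos, one_lt_two⟩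
  let χ : ℂ → ℂ := fun z => (b z : ℂ)
  have hχ : ContDiff ℝ ∞ χ := Complex.ofRealCLM.contDiff.comp b.contDiff
  have hχc : HasCompactSupport χ := b.hasCompactSupport.comp_left Complex.ofReal_zero
  have hd0 : ∀ z ∈ Metric.ball (0 : ℂ) 1, dbar χ z = 0 := by
    intro z hz
    have h1 : χ =ᶠ[nhds z] fun _ => 1 := by
      filter_upwards [Metric.isOpen_ball.mem_nhds hz] with w hw
      simp only [χ]
      rw [b.one_of_mem_closedBall (Metric.ball_subset_closedBall hw), Complex.ofReal_one]
    have h2 : fderiv ℝ χ z = 0 := by rw [h1.fderiv_eq]; simp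
    simp [dbar, h2]
  have hsm : ContDiff ℝ ∞ (dbar χ) := hχ.dbar_succ (by simp)
  -- The kernel is the Cauchy kernel times $\bar\partial$ of a cutoff; it is smooth at the origin
  -- because the cutoff is constant there.
  have hks : ContDiff ℝ ∞ (fun z => (Real.pi : ℂ)⁻¹ * (dbar χ (-z) / z)) := by
    refine contDiff_const.mul (contDiff_iff_contDiffAt.2 fun z => ?_)
    by_cases hz : z = 0
    · have h1 : (fun z => dbar χ (-z) / z) =ᶠ[nhds z] fun _ => 0 := by
        rw [hz]
        filter_upwards [Metric.ball_mem_nhds (0 : ℂ) one_pos] with w hw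
        rw [hd0 (-w) (by simpa using hw), zero_div]
      exact contDiffAt_const.congr_of_eventuallyEq h1
    · simp only [div_eq_mul_inv]
      exact (hsm.comp contDiff_neg).contDiffAt.mul
        ((contDiffAt_inv ℂ hz).restrict_scalars ℝ)
  have hkc : HasCompactSupport (fun z => (Real.pi : ℂ)⁻¹ * (dbar χ (-z) / z)) := by
    have h1 : HasCompactSupport (fun z => dbar χ (-z)) :=
      hχc.dbar.comp_homeomorph (Homeomorph.neg ℂ)
    refine h1.mono fun z hz hz' => hz ?_
    simp only at hz' ⊢
    rw [hz', zero_div, mul_zero]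
  refine ⟨_, hks, hkc, fun h hh z => ?_⟩
  have hhs : ContDiff ℝ ∞ h := (hh.contDiff (n := ∞)).restrict_scalars ℝ
  have hT : ContDiff ℝ ∞ (fun w => χ (w - z)) := hχ.comp (contDiff_id.sub contDiff_const)
  have hTc : HasCompactSupport (fun w => χ (w - z)) :=
    hχc.comp_homeomorph (Homeomorph.subRight z)
  -- For holomorphic $h$, all of $\bar\partial(\chi(\cdot-z)h)$ falls on the cutoff, so
  -- Cauchy–Pompeiu at $z$ becomes a convolution of $h$ with the kernel.
  have hP := integral_dbar_div_sub (χ := fun w => χ (w - z) * h w)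
    ((hT.mul hhs).of_le (by simp)) hTc.mul_right z
  have hχ0 : χ 0 = 1 := by
    simp only [χ]
    rw [b.one_of_mem_closedBall (by simp [b]), Complex.ofReal_one]
  rw [sub_self, hχ0, one_mul] at hP
  have hpi : (Real.pi : ℂ) ≠ 0 := by exact_mod_cast Real.pi_ne_zero
  have hz : h z = -(Real.pi : ℂ)⁻¹ * ∫ w, dbar (fun w => χ (w - z) * h w) w / (w - z) := by
    rw [hP]; field_simp
  rw [hz, convolution_def, ← integral_const_mul]
  congr 1
  ext w
  have hdb : dbar (fun w => χ (w - z) * h w) w = dbar χ (w - z) * h w := by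
    rw [dbar_mul (hT.differentiable (by simp) w) (hhs.differentiable (by simp) w),
      dbar_eq_zero_of_differentiableAt (hh w), mul_zero, add_zero]
    simp only [dbar, sub_eq_add_neg, fderiv_comp_add_right]
  rw [hdb]
  simp only [ContinuousLinearMap.mul_apply', neg_sub]
  rw [← neg_sub w z, div_neg]
  ring

/-- The derivative of the convolution falls on $\rho$, and $t\mapsto\rho(z-t)$ is itself a test
function. -/
theorem differentiable_convolution_of_integral_dbar_eq_zero {u ρ : ℂ → ℂ}
    (hu : LocallyIntegrable u)
    (h0 : ∀ χ : ℂ → ℂ, ContDiff ℝ ∞ χ → HasCompactSupport χ → ∫ z, u z * dbar χ z = 0)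
    (hρ : ContDiff ℝ ∞ ρ) (hc : HasCompactSupport ρ) :
    Differentiable ℂ (convolution u ρ (mul ℝ ℂ) volume) := by
  intro z
  have hd := hc.hasFDerivAt_convolution_right (mul ℝ ℂ) hu (hρ.of_le (by simp)) z
  refine differentiableAt_of_dbar_eq_zero hd.differentiableAt ?_
  have hfc : HasCompactSupport (fderiv ℝ ρ) := hc.fderiv ℝ
  have hfs : Continuous (fderiv ℝ ρ) := hρ.continuous_fderiv (by simp)
  have hint := hfc.convolutionExists_right (μ := volume)
    (ContinuousLinearMap.precompR ℂ (mul ℝ ℂ)) hu hfs z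
  have happ : ∀ v, convolution u (fderiv ℝ ρ) (ContinuousLinearMap.precompR ℂ (mul ℝ ℂ))
      volume z v = ∫ t, u t * fderiv ℝ ρ (z - t) v := by
    intro v
    rw [convolution_def, ContinuousLinearMap.integral_apply hint]
    rfl
  have hint' : ∀ v, Integrable fun t => u t * fderiv ℝ ρ (z - t) v := by
    intro v
    exact (ContinuousLinearMap.apply ℝ ℂ v).integrable_comp hint
  have hχ := h0 (fun t => ρ (z - t)) (hρ.comp (contDiff_const.sub contDiff_id))
    (hc.comp_homeomorph (Homeomorph.subLeft z))
  rw [dbar, hd.fderiv, happ, happ, ← integral_const_mul, ← integral_add (hint' _)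
    ((hint' _).const_mul _), ← integral_const_mul, ← neg_eq_zero, ← integral_neg, ← hχ]
  congr 1
  ext t
  have hf : ∀ v, fderiv ℝ (fun t => ρ (z - t)) t v = -fderiv ℝ ρ (z - t) v := by
    intro v
    have := (hρ.differentiable (by simp) (z - t)).hasFDerivAt.comp t
      ((hasFDerivAt_id t).const_sub z)
    have h2 : fderiv ℝ (fun t => ρ (z - t)) t = _ := this.fderiv
    rw [h2]; simp
  simp only [dbar, hf]
  ring

/-- Associativity, followed by commutativity for the two kernels; compact support of the kernels
makes up for $u$ being only locally integrable. -/
theorem convolution_right_comm {u κ ρ : ℂ → ℂ} (hu : LocallyIntegrable u)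
    (hκ : Continuous κ) (hκc : HasCompactSupport κ) (hρ : Continuous ρ)
    (hρc : HasCompactSupport ρ) (z : ℂ) :
    convolution (convolution u κ (mul ℝ ℂ) volume) ρ (mul ℝ ℂ) volume z =
      convolution (convolution u ρ (mul ℝ ℂ) volume) κ (mul ℝ ℂ) volume z := by
  have hassoc : ∀ κ ρ : ℂ → ℂ, Continuous κ → HasCompactSupport κ → Continuous ρ →
      HasCompactSupport ρ →
      convolution (convolution u κ (mul ℝ ℂ) volume) ρ (mul ℝ ℂ) volume z =
      convolution u (convolution κ ρ (mul ℝ ℂ) volume) (mul ℝ ℂ) volume z := by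
    intro κ ρ hκ hκc hρ hρc
    refine convolution_assoc _ _ _ _ (fun x y z => mul_assoc x y z) hu.aestronglyMeasurable
      hκ.aestronglyMeasurable hρ.aestronglyMeasurable ?_ ?_ ?_
    · exact Filter.Eventually.of_forall (hκc.convolutionExists_right _ hu hκ)
    · exact Filter.Eventually.of_forall
        (hρc.norm.convolutionExists_right _ hκ.norm.locallyIntegrable hρ.norm)
    · refine HasCompactSupport.convolutionExists_right _ (hκc.norm.convolution _ hρc.norm)
        (fun x => (hu x).norm) ?_ z
      exact hρc.norm.continuous_convolution_right _ hκ.norm.locallyIntegrable hρ.norm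
  rw [hassoc κ ρ hκ hκc hρ hρc, hassoc ρ κ hρ hρc hκ hκc]
  congr 1
  rw [← convolution_flip]
  congr 1
  ext; simp

/-- **Weyl's lemma**: a weakly holomorphic function is almost everywhere equal to an entire
function. -/
theorem exists_entire_ae_eq_of_integral_dbar_eq_zero {u : ℂ → ℂ} (hu : LocallyIntegrable u)
    (h0 : ∀ χ : ℂ → ℂ, ContDiff ℝ ∞ χ → HasCompactSupport χ → ∫ z, u z * dbar χ z = 0) :
    ∃ h : ℂ → ℂ, Differentiable ℂ h ∧ u =ᵐ[volume] h := by
  obtain ⟨ρ, hρ, hρc, hrep⟩ := exists_reproducing_kernel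
  have hent := differentiable_convolution_of_integral_dbar_eq_zero hu h0 hρ hρc
  refine ⟨_, hent, ?_⟩
  set h := convolution u ρ (mul ℝ ℂ) volume with hdef
  let φ : ℕ → ContDiffBump (0 : ℂ) := fun i =>
    ⟨1 / ((i : ℝ) + 1), 2 / ((i : ℝ) + 1), by positivity, by gcongr; norm_num⟩
  have hout : Filter.Tendsto (fun i => (φ i).rOut) Filter.atTop (nhds 0) := by
    have := (tendsto_one_div_add_atTop_nhds_zero_nat (𝕜 := ℝ)).const_mul 2
    simpa [φ, div_eq_mul_inv] using this
  -- A bounded ratio of radii is what Lebesgue differentiation needs for a.e. convergence of the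
  -- mollifications of $u$.
  have hK : ∀ᶠ i in Filter.atTop, (φ i).rOut ≤ 2 * (φ i).rIn :=
    Filter.Eventually.of_forall fun i => le_of_eq (by simp only [φ]; ring)
  have hconv : ∀ (v : ℂ → ℂ) (i : ℕ) (z : ℂ),
      convolution ((φ i).normed volume) v (ContinuousLinearMap.lsmul ℝ ℝ) volume z =
      convolution v (fun w => (((φ i).normed volume w : ℝ) : ℂ)) (mul ℝ ℂ) volume z := by
    intro v i z
    rw [convolution_lsmul_swap, convolution_def]
    congr 1
    ext t
    rw [Complex.real_smul, ContinuousLinearMap.mul_apply', mul_comm]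
  have hu' := ContDiffBump.ae_convolution_tendsto_right_of_locallyIntegrable hout hK hu
  have hh' := ContDiffBump.ae_convolution_tendsto_right_of_locallyIntegrable hout hK
    (hent.continuous.locallyIntegrable (μ := volume))
  filter_upwards [hu', hh'] with z h1 h2
  refine tendsto_nhds_unique h1 (h2.congr fun i => ?_)
  have hκ : ContDiff ℝ ∞ (fun w => (((φ i).normed volume w : ℝ) : ℂ)) :=
    Complex.ofRealCLM.contDiff.comp (φ i).contDiff_normed
  have hκc : HasCompactSupport (fun w => (((φ i).normed volume w : ℝ) : ℂ)) :=
    (φ i).hasCompactSupport_normed.comp_left Complex.ofReal_zero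
  -- $u*\varphi_i$ is entire, hence reproduced by $\rho$:
  -- $h*\varphi_i=(u*\varphi_i)*\rho=u*\varphi_i$. Both sequences coincide, and so do their a.e.
  -- limits $h$ and $u$.
  rw [hconv, hconv, hdef,
    ← convolution_right_comm hu hκ.continuous hκc hρ.continuous hρc,
    hrep _ (differentiable_convolution_of_integral_dbar_eq_zero hu h0 hκ hκc)]

end Weyl

/-! ### Functions of class `C^{1,1}` -/

/-- Rademacher on each disc of integer radius, then a countable union of null sets. -/
theorem LocallyLipschitz.ae_differentiableAt {F : Type*} [NormedAddCommGroup F] [NormedSpace ℝ F]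
    [FiniteDimensional ℝ F] {f : ℂ → F} (hf : LocallyLipschitz f) :
    ∀ᵐ z : ℂ, DifferentiableAt ℝ f z := by
  have h : ∀ n : ℕ, ∀ᵐ z : ℂ, z ∈ Metric.ball (0 : ℂ) n → DifferentiableAt ℝ f z := by
    intro n
    obtain ⟨C, hC⟩ := (hf.locallyLipschitzOn (s := Metric.closedBall (0 : ℂ) n)
      ).exists_lipschitzOnWith_of_compact (isCompact_closedBall _ _)
    filter_upwards [(hC.mono Metric.ball_subset_closedBall).ae_differentiableWithinAt_of_mem
      (μ := volume)] with z hz hzn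
    exact (hz hzn).differentiableAt (Metric.isOpen_ball.mem_nhds hzn)
  filter_upwards [ae_all_iff.2 h] with z hz
  obtain ⟨n, hn⟩ := exists_nat_gt ‖z‖
  exact hz n (by simpa using hn)

theorem normLaplacian_eq_fderiv (g : ℂ → ℝ) (z : ℂ) :
    normLaplacian g z = (1 / 4 : ℝ) * (fderiv ℝ (fderiv ℝ g) z 1 1 +
      fderiv ℝ (fderiv ℝ g) z Complex.I Complex.I) := by
  rw [normLaplacian, InnerProductSpace.laplacian_eq_iteratedFDeriv_complexPlane]
  simp [iteratedFDeriv_two_apply]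

theorem IsC11.add {f g : ℂ → ℝ} (hf : IsC11 f) (hg : IsC11 g) : IsC11 (fun z => f z + g z) := by
  refine ⟨hf.1.add hg.1, ?_⟩
  have h : fderiv ℝ (fun z => f z + g z) = fun z => fderiv ℝ f z + fderiv ℝ g z := by
    ext1 z
    exact fderiv_fun_add (hf.1.differentiable one_ne_zero z) (hg.1.differentiable one_ne_zero z)
  rw [h]
  exact hf.2.add hg.2

theorem IsC11.ae_normLaplacian_add {f g : ℂ → ℝ} (hf : IsC11 f) (hg : IsC11 g) :
    ∀ᵐ z : ℂ, normLaplacian (fun z => f z + g z) z = normLaplacian f z + normLaplacian g z := by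
  have h : fderiv ℝ (fun z => f z + g z) = fun z => fderiv ℝ f z + fderiv ℝ g z := by
    ext1 z
    exact fderiv_fun_add (hf.1.differentiable one_ne_zero z) (hg.1.differentiable one_ne_zero z)
  filter_upwards [hf.2.ae_differentiableAt, hg.2.ae_differentiableAt] with z h1 h2
  simp only [normLaplacian_eq_fderiv, h, fderiv_fun_add h1 h2, add_apply]
  ring

/-! ### The Bochner–Kodaira inequality for $C^{1,1}$ weights. -/

section BasicInequality

variable {ψ : ℂ → ℝ}

theorem fderiv_ofReal_comp {z : ℂ} (h : DifferentiableAt ℝ ψ z) (v : ℂ) :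
    fderiv ℝ (fun w => (ψ w : ℂ)) z v = (fderiv ℝ ψ z v : ℂ) := by
  have := (Complex.ofRealCLM.hasFDerivAt.comp z h.hasFDerivAt).fderiv
  have h2 : (fun w => (ψ w : ℂ)) = (Complex.ofRealCLM ∘ ψ) := by ext; simp
  rw [h2, this]; simp

/-- The derivative `∂ψ` of a function of class `C^{1,1}` is locally Lipschitz. -/
theorem IsC11.locallyLipschitz_wirtingerDel (hψ : IsC11 ψ) :
    LocallyLipschitz (wirtingerDel fun w => (ψ w : ℂ)) := by
  have h : wirtingerDel (fun w => (ψ w : ℂ)) = fun z =>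
      (1 / 2 : ℂ) * ((fderiv ℝ ψ z 1 : ℂ) - Complex.I * (fderiv ℝ ψ z Complex.I : ℂ)) := by
    ext z
    rw [wirtingerDel, fderiv_ofReal_comp (hψ.1.differentiable one_ne_zero z),
      fderiv_ofReal_comp (hψ.1.differentiable one_ne_zero z)]
  rw [h]
  have h2 : ContDiff ℝ 1 (fun L : ℂ →L[ℝ] ℝ =>
      (1 / 2 : ℂ) * ((L 1 : ℂ) - Complex.I * (L Complex.I : ℂ))) := by
    have h3 : ∀ v : ℂ, ContDiff ℝ 1 (fun L : ℂ →L[ℝ] ℝ => (L v : ℂ)) := fun v =>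
      Complex.ofRealCLM.contDiff.comp (contDiff_id.clm_apply contDiff_const)
    exact contDiff_const.mul ((h3 1).sub (contDiff_const.mul (h3 _)))
  exact h2.locallyLipschitz.comp hψ.2

/-- In $\bar\partial\partial\psi$ the mixed derivatives cancel, because second derivatives are
symmetric wherever the gradient is differentiable. -/
theorem IsC11.dbar_wirtingerDel (hψ : IsC11 ψ) {z : ℂ}
    (hz : DifferentiableAt ℝ (fderiv ℝ ψ) z) :
    DifferentiableAt ℝ (wirtingerDel fun w => (ψ w : ℂ)) z ∧
      dbar (wirtingerDel fun w => (ψ w : ℂ)) z = normLaplacian ψ z := by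
  have h : wirtingerDel (fun w => (ψ w : ℂ)) = fun z =>
      (1 / 2 : ℂ) * ((fderiv ℝ ψ z 1 : ℂ) - Complex.I * (fderiv ℝ ψ z Complex.I : ℂ)) := by
    ext z
    rw [wirtingerDel, fderiv_ofReal_comp (hψ.1.differentiable one_ne_zero z),
      fderiv_ofReal_comp (hψ.1.differentiable one_ne_zero z)]
  have hsymm : fderiv ℝ (fderiv ℝ ψ) z 1 Complex.I = fderiv ℝ (fderiv ℝ ψ) z Complex.I 1 :=
    second_derivative_symmetric
      (fun y => (hψ.1.differentiable one_ne_zero y).hasFDerivAt) hz.hasFDerivAt 1 Complex.I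
  have hd : ∀ v : ℂ, HasFDerivAt (fun w => (fderiv ℝ ψ w v : ℂ))
      (Complex.ofRealCLM.comp ((ContinuousLinearMap.apply ℝ ℝ v).comp
        (fderiv ℝ (fderiv ℝ ψ) z))) z := fun v =>
    Complex.ofRealCLM.hasFDerivAt.comp z
      ((ContinuousLinearMap.apply ℝ ℝ v).hasFDerivAt.comp z hz.hasFDerivAt)
  have hq := ((hd 1).sub ((hd Complex.I).const_mul Complex.I)).const_mul (1 / 2 : ℂ)
  have hq' := hq.congr_of_eventuallyEq (f₁ := wirtingerDel fun w => (ψ w : ℂ))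
    (Filter.Eventually.of_forall fun w => congrFun h w)
  refine ⟨hq'.differentiableAt, ?_⟩
  rw [dbar, hq'.fderiv, normLaplacian_eq_fderiv]
  simp [hsymm]
  linear_combination (-(1 / 4) * (fderiv ℝ (fderiv ℝ ψ) z Complex.I Complex.I : ℂ)) * Complex.I_sq

theorem wirtingerDel_dbar_comm {η : ℂ → ℂ} (hη : ContDiff ℝ ∞ η) (z : ℂ) :
    wirtingerDel (dbar η) z = dbar (wirtingerDel η) z := by
  have hd : DifferentiableAt ℝ (fderiv ℝ η) z :=
    (hη.fderiv_right (m := ∞) (by simp)).differentiable (by simp) z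
  have hsymm : fderiv ℝ (fderiv ℝ η) z 1 Complex.I = fderiv ℝ (fderiv ℝ η) z Complex.I 1 :=
    second_derivative_symmetric
      (fun y => (hη.differentiable (by simp) y).hasFDerivAt) hd.hasFDerivAt 1 Complex.I
  have hv : ∀ v : ℂ, HasFDerivAt (fun w => fderiv ℝ η w v)
      ((ContinuousLinearMap.apply ℝ ℂ v).comp (fderiv ℝ (fderiv ℝ η) z)) z := fun v =>
    (ContinuousLinearMap.apply ℝ ℂ v).hasFDerivAt.comp z hd.hasFDerivAt
  have h1 : HasFDerivAt (dbar η) _ z :=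
    ((hv 1).add ((hv Complex.I).const_mul Complex.I)).const_mul (1 / 2 : ℂ)
  have h2 : HasFDerivAt (wirtingerDel η) _ z :=
    ((hv 1).sub ((hv Complex.I).const_mul Complex.I)).const_mul (1 / 2 : ℂ)
  rw [wirtingerDel, dbar, h1.fderiv, h2.fderiv]
  simp [hsymm]
  ring

theorem contDiff_exp_ofReal (hψ : ContDiff ℝ 1 ψ) :
    ContDiff ℝ 1 (fun z => (Real.exp (ψ z) : ℂ)) :=
  Complex.ofRealCLM.contDiff.comp hψ.exp

theorem fderiv_exp_ofReal {z : ℂ} (h : DifferentiableAt ℝ ψ z) (v : ℂ) :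
    fderiv ℝ (fun w => (Real.exp (ψ w) : ℂ)) z v =
      (Real.exp (ψ z) : ℂ) * (fderiv ℝ ψ z v : ℂ) := by
  rw [fderiv_ofReal_comp h.exp, fderiv_exp h]
  simp

theorem wirtingerDel_exp {z : ℂ} (h : DifferentiableAt ℝ ψ z) :
    wirtingerDel (fun w => (Real.exp (ψ w) : ℂ)) z =
      (Real.exp (ψ z) : ℂ) * wirtingerDel (fun w => (ψ w : ℂ)) z := by
  simp only [wirtingerDel, fderiv_exp_ofReal h, fderiv_ofReal_comp h]
  ring

theorem dbar_exp {z : ℂ} (h : DifferentiableAt ℝ ψ z) :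
    dbar (fun w => (Real.exp (ψ w) : ℂ)) z =
      (Real.exp (ψ z) : ℂ) * dbar (fun w => (ψ w : ℂ)) z := by
  simp only [dbar, fderiv_exp_ofReal h, fderiv_ofReal_comp h]
  ring

theorem dbar_ofReal {z : ℂ} (h : DifferentiableAt ℝ ψ z) :
    dbar (fun w => (ψ w : ℂ)) z = (starRingEnd ℂ) (wirtingerDel (fun w => (ψ w : ℂ)) z) := by
  simp only [dbar, wirtingerDel, fderiv_ofReal_comp h]
  simp [map_ofNat]

theorem LocallyLipschitz.conj {f : ℂ → ℂ} (hf : LocallyLipschitz f) :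
    LocallyLipschitz (fun z => (starRingEnd ℂ) (f z)) :=
  (Complex.conjCLE.contDiff (n := 1) (𝕜 := ℝ)).locallyLipschitz.comp hf

/-- The Bochner–Kodaira identity integrated against a test function, as an inequality. -/
theorem IsC11.integral_normLaplacian_le (hψ : IsC11 ψ) {η : ℂ → ℂ} (hη : ContDiff ℝ ∞ η)
    (hc : HasCompactSupport η) :
    Integrable (fun z => ‖η z‖ ^ 2 * normLaplacian ψ z * Real.exp (ψ z)) ∧
      ∫ z, ‖η z‖ ^ 2 * normLaplacian ψ z * Real.exp (ψ z) ≤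
        ∫ z, ‖dbar η z‖ ^ 2 * Real.exp (ψ z) := by
  set q := wirtingerDel (fun w => (ψ w : ℂ)) with hq
  set e : ℂ → ℂ := fun z => (Real.exp (ψ z) : ℂ) with he
  -- $D=e^{-\psi}\partial(e^{\psi}\eta)$ is the twisted $\partial$-derivative; its commutator with
  -- $\bar\partial$ is multiplication by $\Delta\psi$.
  set D : ℂ → ℂ := fun z => wirtingerDel η z + η z * q z with hD
  have hqL : LocallyLipschitz q := hψ.locallyLipschitz_wirtingerDel
  have hηL : LocallyLipschitz η := (hη.of_le (by simp)).locallyLipschitz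
  have hdη : ContDiff ℝ ∞ (dbar η) := hη.dbar_succ (by simp)
  have hwη : ContDiff ℝ ∞ (wirtingerDel η) := hη.wirtingerDel_succ (by simp)
  have heL : LocallyLipschitz e := (contDiff_exp_ofReal hψ.1).locallyLipschitz
  have hDL : LocallyLipschitz D := by
    have h1 := (hwη.of_le (m := 1) (by simp)).locallyLipschitz
    exact h1.add (hηL.mul_complex hqL)
  set h1 : ℂ → ℂ := fun z => η z * (starRingEnd ℂ) (dbar η z) * e z with hh1
  set h2 : ℂ → ℂ := fun z => η z * e z * (starRingEnd ℂ) (D z) with hh2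
  have h1L : LocallyLipschitz h1 :=
    (hηL.mul_complex (hdη.of_le (m := 1) (by simp)).locallyLipschitz.conj).mul_complex heL
  have h2L : LocallyLipschitz h2 := (hηL.mul_complex heL).mul_complex hDL.conj
  have h1c : HasCompactSupport h1 := hc.mul_right.mul_right
  have h2c : HasCompactSupport h2 := hc.mul_right.mul_right
  set G : ℂ → ℝ := fun z => ‖dbar η z‖ ^ 2 * Real.exp (ψ z) with hG
  set E : ℂ → ℝ := fun z => ‖D z‖ ^ 2 * Real.exp (ψ z) with hE
  have hexpc : Continuous (fun z => Real.exp (ψ z)) := hψ.1.continuous.rexp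
  have hGi : Integrable G := by
    refine Continuous.integrable_of_hasCompactSupport
      ((hdη.continuous.norm.pow 2).mul hexpc) ?_
    exact hc.dbar.mono fun z hz => by
      contrapose! hz
      simp only [Function.notMem_support] at hz ⊢
      simp [hG, hz]
  have hDc : HasCompactSupport D := by
    refine hc.mono' fun z hz => ?_
    by_contra h
    have h3 : fderiv ℝ η z = 0 := by
      by_contra h'
      exact h (support_fderiv_subset ℝ h')
    simp [hD, wirtingerDel, h3, image_eq_zero_of_notMem_tsupport h] at hz
  have hEi : Integrable E := by
    refine Continuous.integrable_of_hasCompactSupport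
      ((hDL.continuous.norm.pow 2).mul hexpc) ?_
    exact hDc.mono fun z hz => by
      contrapose! hz
      simp only [Function.notMem_support] at hz ⊢
      simp [hE, hz]
  -- $\bar\partial h_1$ contains $|\bar\partial\eta|^2e^{\psi}$, and $\partial h_2$ contains
  -- $|D|^2e^{\psi}+|\eta|^2\Delta\psi\,e^{\psi}$; their remaining terms agree. Both derivatives
  -- integrate to zero, and dropping $E\ge0$ gives the inequality.
  have hpt : ∀ᵐ z : ℂ, ((‖η z‖ ^ 2 * normLaplacian ψ z * Real.exp (ψ z) : ℝ) : ℂ) =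
      (G z : ℂ) - (E z : ℂ) - (dbar h1 z - wirtingerDel h2 z) := by
    filter_upwards [hψ.2.ae_differentiableAt] with z hz
    obtain ⟨hqd, hqv⟩ := hψ.dbar_wirtingerDel hz
    have dη : DifferentiableAt ℝ η z := hη.differentiable (by simp) z
    have ddη : DifferentiableAt ℝ (dbar η) z := hdη.differentiable (by simp) z
    have dwη : DifferentiableAt ℝ (wirtingerDel η) z := hwη.differentiable (by simp) z
    have dψ : DifferentiableAt ℝ ψ z := hψ.1.differentiable one_ne_zero z
    have de : DifferentiableAt ℝ e z := (contDiff_exp_ofReal hψ.1).differentiable one_ne_zero z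
    have dD : DifferentiableAt ℝ D z := dwη.add (dη.fun_mul hqd)
    have cj : ∀ {f : ℂ → ℂ}, DifferentiableAt ℝ f z →
        DifferentiableAt ℝ (fun z => (starRingEnd ℂ) (f z)) z := fun hf =>
      (Complex.conjCLE.differentiableAt (𝕜 := ℝ)).comp z hf
    have hde : dbar e z = e z * (starRingEnd ℂ) (q z) := by
      rw [he, dbar_exp dψ, dbar_ofReal dψ]
    have hwe : wirtingerDel e z = e z * q z := by rw [he, wirtingerDel_exp dψ]
    have e1 : dbar h1 z = (dbar η z * (starRingEnd ℂ) (dbar η z) +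
        η z * (starRingEnd ℂ) (wirtingerDel (dbar η) z)) * e z +
        η z * (starRingEnd ℂ) (dbar η z) * (e z * (starRingEnd ℂ) (q z)) := by
      rw [hh1, dbar_mul (dη.fun_mul (cj ddη)) de, dbar_mul dη (cj ddη), dbar_conj ddη, hde]
    have e2 : wirtingerDel h2 z = (wirtingerDel η z * e z + η z * (e z * q z)) *
        (starRingEnd ℂ) (D z) + η z * e z * (starRingEnd ℂ) (dbar (wirtingerDel η) z +
          (dbar η z * q z + η z * (normLaplacian ψ z : ℂ))) := by
      rw [hh2, wirtingerDel_mul (dη.fun_mul de) (cj dD), wirtingerDel_mul dη de,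
        wirtingerDel_conj dD, hwe, hD, dbar_add dwη (dη.fun_mul hqd), dbar_mul dη hqd, hqv]
    have n1 : ((‖dbar η z‖ ^ 2 : ℝ) : ℂ) = dbar η z * (starRingEnd ℂ) (dbar η z) := by
      rw [Complex.mul_conj, Complex.normSq_eq_norm_sq]
    have n2 : ((‖D z‖ ^ 2 : ℝ) : ℂ) = D z * (starRingEnd ℂ) (D z) := by
      rw [Complex.mul_conj, Complex.normSq_eq_norm_sq]
    have n3 : ((‖η z‖ ^ 2 : ℝ) : ℂ) = η z * (starRingEnd ℂ) (η z) := by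
      rw [Complex.mul_conj, Complex.normSq_eq_norm_sq]
    rw [e1, e2, wirtingerDel_dbar_comm hη]
    simp only [hG, hE]
    rw [Complex.ofReal_mul, Complex.ofReal_mul, Complex.ofReal_mul, Complex.ofReal_mul, n1, n2,
      n3]
    simp only [hD, he, map_add, map_mul, Complex.conj_ofReal]
    ring
  have hJi : Integrable (fun z => (G z : ℂ) - (E z : ℂ) - (dbar h1 z - wirtingerDel h2 z)) :=
    (hGi.ofReal.sub hEi.ofReal).sub
      ((h1L.integrable_dbar h1c).sub (h2L.integrable_wirtingerDel h2c))
  have hKC : Integrable (fun z =>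
      ((‖η z‖ ^ 2 * normLaplacian ψ z * Real.exp (ψ z) : ℝ) : ℂ)) :=
    hJi.congr (hpt.mono fun z hz => hz.symm)
  have hK : Integrable (fun z => ‖η z‖ ^ 2 * normLaplacian ψ z * Real.exp (ψ z)) := by
    exact hKC.re
  refine ⟨hK, ?_⟩
  have hGE : Integrable (fun z => (G z : ℂ) - (E z : ℂ)) := hGi.ofReal.sub hEi.ofReal
  have hh12 : Integrable (fun z => dbar h1 z - wirtingerDel h2 z) :=
    (h1L.integrable_dbar h1c).sub (h2L.integrable_wirtingerDel h2c)
  have hval : ((∫ z, ‖η z‖ ^ 2 * normLaplacian ψ z * Real.exp (ψ z) : ℝ) : ℂ) =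
      ((∫ z, G z) - ∫ z, E z : ℝ) := by
    rw [← integral_complex_ofReal, integral_congr_ae hpt, integral_sub hGE hh12,
      integral_sub hGi.ofReal hEi.ofReal,
      integral_sub (h1L.integrable_dbar h1c) (h2L.integrable_wirtingerDel h2c),
      h1L.integral_dbar_eq_zero h1c, h2L.integral_wirtingerDel_eq_zero h2c]
    push_cast
    rw [integral_complex_ofReal, integral_complex_ofReal]
    ring
  have hval' : ∫ z, ‖η z‖ ^ 2 * normLaplacian ψ z * Real.exp (ψ z) =
      (∫ z, G z) - ∫ z, E z := by exact_mod_cast hval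
  have hE0 : 0 ≤ ∫ z, E z := integral_nonneg fun z => by positivity
  rw [hval']
  linarith

end BasicInequality

/-! ### Weighted measures -/

section Weight

variable {ψ : ℂ → ℝ}

theorem measurable_weight (hψ : Continuous ψ) :
    Measurable (fun z => ENNReal.ofReal (Real.exp (-ψ z))) :=
  (hψ.neg.rexp.measurable).ennreal_ofReal

theorem areaMeasure_ae_iff {p : ℂ → Prop} : (∀ᵐ z ∂areaMeasure, p z) ↔ ∀ᵐ z : ℂ, p z := by
  have h0 : ENNReal.ofReal Real.pi⁻¹ ≠ 0 := by
    simpa using Real.pi_pos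
  rw [ae_iff, ae_iff, areaMeasure, Measure.smul_apply, smul_eq_mul, mul_eq_zero, or_iff_right h0]

theorem weightMeasure_ae_iff (hψ : Continuous ψ) {p : ℂ → Prop} :
    (∀ᵐ z ∂weightMeasure ψ, p z) ↔ ∀ᵐ z : ℂ, p z := by
  rw [weightMeasure, ae_withDensity_iff (measurable_weight hψ), areaMeasure_ae_iff]
  refine Filter.eventually_congr (Filter.Eventually.of_forall fun z => ?_)
  simp [Real.exp_pos]

theorem ae_weightMeasure (hψ : Continuous ψ) : ae (weightMeasure ψ) = ae (volume : Measure ℂ) :=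
  Filter.ext fun _ => weightMeasure_ae_iff hψ

theorem aestronglyMeasurable_weightMeasure_iff {E : Type*} [TopologicalSpace E]
    (hψ : Continuous ψ) {u : ℂ → E} :
    AEStronglyMeasurable u (weightMeasure ψ) ↔ AEStronglyMeasurable u volume := by
  constructor
  · exact fun h => h.mono_ac (Measure.ae_le_iff_absolutelyContinuous.1 (ae_weightMeasure hψ).ge)
  · exact fun h => h.mono_ac (Measure.ae_le_iff_absolutelyContinuous.1 (ae_weightMeasure hψ).le)

theorem lintegral_areaMeasure (g : ℂ → ENNReal) :
    ∫⁻ z, g z ∂areaMeasure = ENNReal.ofReal Real.pi⁻¹ * ∫⁻ z, g z := by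
  rw [areaMeasure, lintegral_smul_measure, smul_eq_mul]

theorem lintegral_weightMeasure (hψ : Continuous ψ) (g : ℂ → ENNReal) :
    ∫⁻ z, g z ∂weightMeasure ψ =
      ∫⁻ z, ENNReal.ofReal (Real.exp (-ψ z)) * g z ∂areaMeasure := by
  rw [weightMeasure, lintegral_withDensity_eq_lintegral_mul_non_measurable _
    (measurable_weight hψ) (Filter.Eventually.of_forall fun _ => ENNReal.ofReal_lt_top)]
  rfl

theorem integral_weightMeasure {E : Type*} [NormedAddCommGroup E] [NormedSpace ℝ E]
    (hψ : Continuous ψ) (g : ℂ → E) :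
    ∫ z, g z ∂weightMeasure ψ = Real.pi⁻¹ • ∫ z, Real.exp (-ψ z) • g z := by
  rw [weightMeasure, integral_withDensity_eq_integral_toReal_smul (measurable_weight hψ)
    (Filter.Eventually.of_forall fun _ => ENNReal.ofReal_lt_top), areaMeasure,
    integral_smul_measure, ENNReal.toReal_ofReal (inv_nonneg.2 Real.pi_pos.le)]
  congr 2
  ext z
  rw [ENNReal.toReal_ofReal (Real.exp_pos _).le]

/-- The square of the `L²_ψ`-norm as a lower integral. -/
theorem eLpNorm_weightMeasure_sq (hψ : Continuous ψ) (u : ℂ → ℂ) :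
    eLpNorm u 2 (weightMeasure ψ) ^ 2 =
      ∫⁻ z, ENNReal.ofReal (‖u z‖ ^ 2 * Real.exp (-ψ z)) ∂areaMeasure := by
  rw [eLpNorm_eq_lintegral_rpow_enorm_toReal two_ne_zero ENNReal.ofNat_ne_top,
    ← ENNReal.rpow_natCast, ← ENNReal.rpow_mul]
  simp only [ENNReal.toReal_ofNat, Nat.cast_ofNat]
  norm_num
  rw [lintegral_weightMeasure hψ]
  refine lintegral_congr fun z => ?_
  rw [mul_comm]

theorem mem_L2_iff (hψ : Continuous ψ) {u : ℂ → ℂ} :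
    u ∈ L2 ψ ↔ AEStronglyMeasurable u volume ∧
      ∫⁻ z, ENNReal.ofReal (‖u z‖ ^ 2 * Real.exp (-ψ z)) ∂areaMeasure < ⊤ := by
  rw [← eLpNorm_weightMeasure_sq hψ, L2, Set.mem_ofPred_eq, MemLp,
    aestronglyMeasurable_weightMeasure_iff hψ]
  simp [lt_top_iff_ne_top]

theorem isFiniteMeasureOnCompacts_weightMeasure (hψ : Continuous ψ) :
    IsFiniteMeasureOnCompacts (weightMeasure ψ) := by
  have : IsLocallyFiniteMeasure areaMeasure := by
    change IsLocallyFiniteMeasure ((Real.pi⁻¹).toNNReal • (volume : Measure ℂ))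
    infer_instance
  have h : IsLocallyFiniteMeasure (weightMeasure ψ) :=
    IsLocallyFiniteMeasure.withDensity_ofReal hψ.neg.rexp
  infer_instance

end Weight

/-! ### Hörmander's estimate -/

/-- The bound makes $L$ factor through a bounded functional on the range of $T$; Hahn–Banach extends
it with the same norm and Riesz represents it. The range need not be closed or dense. -/
theorem exists_inner_representation {V H : Type*} [AddCommGroup V] [Module ℂ V]
    [NormedAddCommGroup H] [InnerProductSpace ℂ H] [CompleteSpace H] (T : V →ₗ[ℂ] H)
    (L : V →ₗ[ℂ] ℂ) {C : ℝ} (hC : 0 ≤ C) (hL : ∀ v, ‖L v‖ ≤ C * ‖T v‖) :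
    ∃ w : H, ‖w‖ ≤ C ∧ ∀ v, L v = inner ℂ w (T v) := by
  have hker : LinearMap.ker T ≤ LinearMap.ker L := by
    intro v hv
    have h := hL v
    rw [LinearMap.mem_ker.1 hv, norm_zero, mul_zero] at h
    exact LinearMap.mem_ker.2 (norm_le_zero_iff.1 h)
  let L' : LinearMap.range T →ₗ[ℂ] ℂ :=
    ((LinearMap.ker T).liftQ L hker) ∘ₗ T.quotKerEquivRange.symm.toLinearMap
  have hL' : ∀ v, L' ⟨T v, LinearMap.mem_range_self T v⟩ = L v := by
    intro v
    simp [L', LinearMap.quotKerEquivRange_symm_apply_image]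
  have hb : ∀ x, ‖L' x‖ ≤ C * ‖x‖ := by
    rintro ⟨_, v, rfl⟩
    rw [hL']
    exact hL v
  obtain ⟨g, hg, hgn⟩ := exists_extension_norm_eq (LinearMap.range T) (L'.mkContinuous C hb)
  refine ⟨(InnerProductSpace.toDual ℂ H).symm g, ?_, fun v => ?_⟩
  · rw [LinearIsometryEquiv.norm_map, hgn]
    exact L'.mkContinuous_norm_le hC hb
  · rw [InnerProductSpace.toDual_symm_apply, ← hL' v]
    exact (hg ⟨T v, LinearMap.mem_range_self T v⟩).symm

/-- The space of complex test functions on the plane. -/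
def testFunctions : Submodule ℂ (ℂ → ℂ) where
  carrier := {χ | ContDiff ℝ ∞ χ ∧ HasCompactSupport χ}
  zero_mem' := ⟨contDiff_const, HasCompactSupport.zero⟩
  add_mem' h₁ h₂ := ⟨h₁.1.add h₂.1, h₁.2.add h₂.2⟩
  smul_mem' _ _ h := ⟨contDiff_const.mul h.1, h.2.mul_left⟩

theorem measurable_normLaplacian (g : ℂ → ℝ) : Measurable (normLaplacian g) := by
  have h : ∀ v : ℂ, Measurable fun z => fderiv ℝ (fderiv ℝ g) z v v := fun v =>
    (ContinuousLinearMap.apply ℝ ℝ v).continuous.measurable.comp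
      (measurable_fderiv_apply_const ℝ (fderiv ℝ g) v)
  have h2 : normLaplacian g = fun z => (1 / 4 : ℝ) * (fderiv ℝ (fderiv ℝ g) z 1 1 +
      fderiv ℝ (fderiv ℝ g) z Complex.I Complex.I) := funext (normLaplacian_eq_fderiv g)
  rw [h2]
  exact ((h 1).add (h _)).const_mul _

theorem integral_mul_le_sqrt_mul_sqrt {α : Type*} [MeasurableSpace α] {μ : Measure α}
    {f g : α → ℝ} (hf : AEStronglyMeasurable f μ) (hg : AEStronglyMeasurable g μ)
    (hf0 : 0 ≤ᵐ[μ] f) (hg0 : 0 ≤ᵐ[μ] g) (hf2 : Integrable (fun x => f x ^ 2) μ)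
    (hg2 : Integrable (fun x => g x ^ 2) μ) :
    ∫ x, f x * g x ∂μ ≤ √(∫ x, f x ^ 2 ∂μ) * √(∫ x, g x ^ 2 ∂μ) := by
  have h := integral_mul_le_Lp_mul_Lq_of_nonneg (μ := μ) (f := f) (g := g)
    Real.HolderConjugate.two_two hf0 hg0
    (by simpa using (memLp_two_iff_integrable_sq hf).2 hf2)
    (by simpa using (memLp_two_iff_integrable_sq hg).2 hg2)
  simpa [Real.sqrt_eq_rpow] using h

section Hormander

variable {ψ : ℂ → ℝ} {F : ℂ → ℂ}

/-- Cauchy–Schwarz with the reciprocal weights $e^{-\psi}/\Delta\psi$ and $\Delta\psi\,e^{\psi}$;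
Bochner–Kodaira bounds the second factor. -/
theorem norm_integral_mul_testFunction_le (hψ : IsC11 ψ) (hpos : IsStrictlySubharmonic ψ)
    (hF : LocallyIntegrable F)
    (hfin : Integrable (fun z => ‖F z‖ ^ 2 * (Real.exp (-ψ z) / normLaplacian ψ z)))
    {η : ℂ → ℂ} (hη : ContDiff ℝ ∞ η) (hc : HasCompactSupport η) :
    ‖∫ z, F z * η z‖ ≤ √(∫ z, ‖F z‖ ^ 2 * (Real.exp (-ψ z) / normLaplacian ψ z)) *
      √(∫ z, ‖dbar η z‖ ^ 2 * Real.exp (ψ z)) := by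
  obtain ⟨hK, hle⟩ := hψ.integral_normLaplacian_le hη hc
  set f : ℂ → ℝ := fun z => ‖F z‖ * √(Real.exp (-ψ z) / normLaplacian ψ z) with hf
  set g : ℂ → ℝ := fun z => ‖η z‖ * √(normLaplacian ψ z * Real.exp (ψ z)) with hg
  have hm := measurable_normLaplacian ψ
  have hexp : Measurable fun z => Real.exp (ψ z) := hψ.1.continuous.rexp.measurable
  have hexp' : Measurable fun z => Real.exp (-ψ z) := hψ.1.continuous.neg.rexp.measurable
  have hfm : AEStronglyMeasurable f := hF.aestronglyMeasurable.norm.mul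
    ((hexp'.div hm).sqrt.aestronglyMeasurable)
  have hgm : AEStronglyMeasurable g := hη.continuous.norm.aestronglyMeasurable.mul
    ((hm.mul hexp).sqrt.aestronglyMeasurable)
  have hf2 : ∀ᵐ z : ℂ, ‖F z‖ ^ 2 * (Real.exp (-ψ z) / normLaplacian ψ z) = f z ^ 2 := by
    filter_upwards [hpos] with z hz
    have : 0 ≤ Real.exp (-ψ z) / normLaplacian ψ z := by positivity
    rw [hf, mul_pow, Real.sq_sqrt this]
  have hg2 : ∀ᵐ z : ℂ, ‖η z‖ ^ 2 * normLaplacian ψ z * Real.exp (ψ z) = g z ^ 2 := by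
    filter_upwards [hpos] with z hz
    have : 0 ≤ normLaplacian ψ z * Real.exp (ψ z) := by positivity
    rw [hg, mul_pow, Real.sq_sqrt this, mul_assoc]
  have hfg : ∀ᵐ z : ℂ, ‖F z * η z‖ = f z * g z := by
    filter_upwards [hpos] with z hz
    have h1 : 0 ≤ Real.exp (-ψ z) / normLaplacian ψ z := by positivity
    have h2 : √(Real.exp (-ψ z) / normLaplacian ψ z) * √(normLaplacian ψ z * Real.exp (ψ z)) = 1 := by
      rw [← Real.sqrt_mul h1, Real.exp_neg]
      field_simp
      simp
    rw [norm_mul, hf, hg]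
    linear_combination (-(‖F z‖ * ‖η z‖)) * h2
  calc ‖∫ z, F z * η z‖ ≤ ∫ z, ‖F z * η z‖ := norm_integral_le_integral_norm _
    _ = ∫ z, f z * g z := integral_congr_ae hfg
    _ ≤ √(∫ z, f z ^ 2) * √(∫ z, g z ^ 2) :=
        integral_mul_le_sqrt_mul_sqrt hfm hgm
          (Filter.Eventually.of_forall fun z => by simp only [hf, Pi.zero_apply]; positivity)
          (Filter.Eventually.of_forall fun z => by simp only [hg, Pi.zero_apply]; positivity)
          (hfin.congr hf2) (hK.congr hg2)
    _ = √(∫ z, ‖F z‖ ^ 2 * (Real.exp (-ψ z) / normLaplacian ψ z)) *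
        √(∫ z, ‖η z‖ ^ 2 * normLaplacian ψ z * Real.exp (ψ z)) := by
        rw [integral_congr_ae hf2, integral_congr_ae hg2]
    _ ≤ _ := by gcongr

theorem LocallyIntegrable.integrable_mul_testFunction (hF : LocallyIntegrable F) {η : ℂ → ℂ}
    (hη : Continuous η) (hc : HasCompactSupport η) : Integrable (fun z => F z * η z) := by
  have := hF.integrable_smul_right_of_hasCompactSupport hη hc
  simpa [mul_comm] using this

/-- **Hörmander's theorem** for the `∂̄` equation on the plane. -/
theorem exists_weighted_dbar_solution (hψ : IsC11 ψ) (hpos : IsStrictlySubharmonic ψ)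
    (hF : LocallyIntegrable F)
    (hfin : ∫⁻ z, ENNReal.ofReal (‖F z‖ ^ 2 * (Real.exp (-ψ z) / normLaplacian ψ z))
      ∂areaMeasure < ⊤) :
    ∃ v ∈ L2 ψ, (∀ χ : ℂ → ℂ, ContDiff ℝ ∞ χ → HasCompactSupport χ →
        ∫ z, v z * dbar χ z = -∫ z, F z * χ z) ∧
      ∫⁻ z, ENNReal.ofReal (‖v z‖ ^ 2 * Real.exp (-ψ z)) ∂areaMeasure ≤
        ∫⁻ z, ENNReal.ofReal (‖F z‖ ^ 2 * (Real.exp (-ψ z) / normLaplacian ψ z))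
          ∂areaMeasure := by
  have hc := hψ.1.continuous
  have hpi : (0 : ℝ) < Real.pi⁻¹ := inv_pos.2 Real.pi_pos
  have := isFiniteMeasureOnCompacts_weightMeasure hc
  have hnn : 0 ≤ᵐ[volume] fun z => ‖F z‖ ^ 2 * (Real.exp (-ψ z) / normLaplacian ψ z) := by
    filter_upwards [hpos] with z hz
    have : 0 ≤ Real.exp (-ψ z) / normLaplacian ψ z := by positivity
    exact mul_nonneg (sq_nonneg _) this
  have hmeas : AEStronglyMeasurable
      (fun z => ‖F z‖ ^ 2 * (Real.exp (-ψ z) / normLaplacian ψ z)) volume :=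
    (hF.aestronglyMeasurable.norm.pow 2).mul
      (hc.neg.rexp.measurable.div (measurable_normLaplacian ψ)).aestronglyMeasurable
  have hfin' : Integrable fun z => ‖F z‖ ^ 2 * (Real.exp (-ψ z) / normLaplacian ψ z) := by
    refine ⟨hmeas, ?_⟩
    rw [hasFiniteIntegral_iff_ofReal hnn]
    rw [lintegral_areaMeasure] at hfin
    exact ENNReal.lt_top_of_mul_ne_top_right hfin.ne (by simpa using Real.pi_pos)
  set A := ∫ z, ‖F z‖ ^ 2 * (Real.exp (-ψ z) / normLaplacian ψ z) with hA
  have hA0 : 0 ≤ A := integral_nonneg_of_ae hnn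
  -- The factor $e^{\psi}$ cancels the density $e^{-\psi}$, so pairing with $T\eta$ in $L^2_\psi$ is
  -- the unweighted pairing with $\bar\partial\eta$, up to $\pi^{-1}$.
  have hT : ∀ η : testFunctions,
      MemLp (fun z => (Real.exp (ψ z) : ℂ) * dbar (η : ℂ → ℂ) z) 2 (weightMeasure ψ) := by
    intro η
    refine Continuous.memLp_of_hasCompactSupport ?_ ?_
    · exact (contDiff_exp_ofReal hψ.1).continuous.mul
        (η.2.1.of_le (by simp)).continuous_dbar
    · exact η.2.2.dbar.mul_left
  let T : testFunctions →ₗ[ℂ] Lp ℂ 2 (weightMeasure ψ) :=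
    { toFun := fun η => (hT η).toLp
      map_add' := by
        intro η₁ η₂
        rw [← MemLp.toLp_add]
        refine MemLp.toLp_congr _ _ (Filter.Eventually.of_forall fun z => ?_)
        have h := dbar_add (η₁.2.1.differentiable (by simp) z) (η₂.2.1.differentiable (by simp) z)
        have h' : dbar (↑(η₁ + η₂) : ℂ → ℂ) z = dbar (η₁ : ℂ → ℂ) z + dbar (η₂ : ℂ → ℂ) z := h
        simp only [h', Pi.add_apply, mul_add]
      map_smul' := by
        intro c η
        rw [RingHom.id_apply, ← MemLp.toLp_const_smul]
        refine MemLp.toLp_congr _ _ (Filter.Eventually.of_forall fun z => ?_)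
        have h := dbar_const_mul (η.2.1.differentiable (by simp) z) c
        have h' : dbar (↑(c • η) : ℂ → ℂ) z = c * dbar (η : ℂ → ℂ) z := h
        simp only [h', Pi.smul_apply, smul_eq_mul]
        ring }
  have hFi : ∀ η : testFunctions, Integrable fun z => F z * (η : ℂ → ℂ) z := fun η =>
    LocallyIntegrable.integrable_mul_testFunction hF η.2.1.continuous η.2.2
  -- The factor $\pi^{-1}$ is the normalization of $dA$; the minus sign is that of the weak
  -- equation.
  let L : testFunctions →ₗ[ℂ] ℂ :=
    { toFun := fun η => -((Real.pi⁻¹ : ℝ) : ℂ) * ∫ z, F z * (η : ℂ → ℂ) z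
      map_add' := by
        intro η₁ η₂
        rw [← mul_add, ← integral_add (hFi η₁) (hFi η₂)]
        congr 2; ext z
        simp [mul_add]
      map_smul' := by
        intro c η
        have h : ∫ z, F z * (↑(c • η) : ℂ → ℂ) z = c * ∫ z, F z * (η : ℂ → ℂ) z := by
          rw [← integral_const_mul]
          refine integral_congr_ae (Filter.Eventually.of_forall fun z => ?_)
          simp only [Submodule.coe_smul, Pi.smul_apply, smul_eq_mul]
          ring
        rw [RingHom.id_apply, smul_eq_mul, h]
        ring }
  have hTn : ∀ η : testFunctions, ‖T η‖ =
      √(Real.pi⁻¹ * ∫ z, ‖dbar (η : ℂ → ℂ) z‖ ^ 2 * Real.exp (ψ z)) := by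
    intro η
    rw [@norm_eq_sqrt_re_inner ℂ, L2.inner_def]
    congr 1
    have h1 : ∫ z, inner ℂ (T η z) (T η z) ∂weightMeasure ψ =
        ∫ z, ((‖dbar (η : ℂ → ℂ) z‖ ^ 2 * Real.exp (ψ z) ^ 2 : ℝ) : ℂ) ∂weightMeasure ψ := by
      refine integral_congr_ae ?_
      filter_upwards [(hT η).coeFn_toLp] with z hz
      have hz' : T η z = _ := hz
      rw [hz', inner_self_eq_norm_sq_to_K, norm_mul, Complex.norm_real,
        Real.norm_of_nonneg (Real.exp_pos _).le]
      simp [mul_pow, mul_comm]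
    rw [h1, integral_weightMeasure hc]
    have h2 : ∀ z, Real.exp (-ψ z) • ((‖dbar (η : ℂ → ℂ) z‖ ^ 2 * Real.exp (ψ z) ^ 2 : ℝ) : ℂ) =
        ((‖dbar (η : ℂ → ℂ) z‖ ^ 2 * Real.exp (ψ z) : ℝ) : ℂ) := by
      intro z
      have h3 : Real.exp (-ψ z) * Real.exp (ψ z) = 1 := by
        rw [← Real.exp_add]; simp
      rw [Complex.real_smul, ← Complex.ofReal_mul]
      congr 1
      linear_combination (‖dbar (η : ℂ → ℂ) z‖ ^ 2 * Real.exp (ψ z)) * h3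
    simp only [h2]
    rw [integral_complex_ofReal, Complex.real_smul, ← Complex.ofReal_mul]
    rfl
  have hbound : ∀ η, ‖L η‖ ≤ √(Real.pi⁻¹ * A) * ‖T η‖ := by
    intro η
    have h1 := norm_integral_mul_testFunction_le hψ hpos hF hfin' η.2.1 η.2.2
    rw [hTn, Real.sqrt_mul hpi.le, Real.sqrt_mul hpi.le]
    have h2 : ‖L η‖ = Real.pi⁻¹ * ‖∫ z, F z * (η : ℂ → ℂ) z‖ := by
      change ‖-((Real.pi⁻¹ : ℝ) : ℂ) * ∫ z, F z * (η : ℂ → ℂ) z‖ = _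
      rw [norm_mul, norm_neg, Complex.norm_real, Real.norm_of_nonneg hpi.le]
    rw [h2]
    have h3 : √Real.pi⁻¹ * √Real.pi⁻¹ = Real.pi⁻¹ := Real.mul_self_sqrt hpi.le
    calc Real.pi⁻¹ * ‖∫ z, F z * (η : ℂ → ℂ) z‖
        ≤ Real.pi⁻¹ * (√A * √(∫ z, ‖dbar (η : ℂ → ℂ) z‖ ^ 2 * Real.exp (ψ z))) := by gcongr
      _ = _ := by
        linear_combination (-(√A * √(∫ z, ‖dbar (η : ℂ → ℂ) z‖ ^ 2 * Real.exp (ψ z)))) * h3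
  obtain ⟨w, hw, hwL⟩ := exists_inner_representation T L (Real.sqrt_nonneg _) hbound
  have hwm : MemLp w 2 (weightMeasure ψ) := Lp.memLp w
  -- The inner product is conjugate-linear in its first slot, so the solution is the conjugate of
  -- the Riesz vector.
  refine ⟨fun z => (starRingEnd ℂ) (w z), hwm.star, ?_, ?_⟩
  · intro χ hχ hχc
    have h := hwL ⟨χ, hχ, hχc⟩
    rw [L2.inner_def] at h
    have h1 : ∫ z, inner ℂ (w z) (T ⟨χ, hχ, hχc⟩ z) ∂weightMeasure ψ =
        ∫ z, (starRingEnd ℂ) (w z) * ((Real.exp (ψ z) : ℂ) * dbar χ z) ∂weightMeasure ψ := by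
      refine integral_congr_ae ?_
      filter_upwards [(hT ⟨χ, hχ, hχc⟩).coeFn_toLp] with z hz
      have hz' : T ⟨χ, hχ, hχc⟩ z = _ := hz
      rw [hz', RCLike.inner_apply, mul_comm]
    rw [h1, integral_weightMeasure hc] at h
    have h2 : ∀ z, Real.exp (-ψ z) • ((starRingEnd ℂ) (w z) *
        ((Real.exp (ψ z) : ℂ) * dbar χ z)) = (starRingEnd ℂ) (w z) * dbar χ z := by
      intro z
      have h3 : (Real.exp (-ψ z) : ℂ) * (Real.exp (ψ z) : ℂ) = 1 := by
        rw [← Complex.ofReal_mul, ← Real.exp_add]; simp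
      rw [Complex.real_smul]
      linear_combination ((starRingEnd ℂ) (w z) * dbar χ z) * h3
    simp only [h2] at h
    have h4 : -((Real.pi⁻¹ : ℝ) : ℂ) * ∫ z, F z * χ z =
        Real.pi⁻¹ • ∫ z, (starRingEnd ℂ) (w z) * dbar χ z := h
    rw [Complex.real_smul] at h4
    have h5 : ((Real.pi⁻¹ : ℝ) : ℂ) ≠ 0 := by exact_mod_cast hpi.ne'
    refine mul_left_cancel₀ h5 ?_
    rw [← h4]; ring
  · rw [← eLpNorm_weightMeasure_sq hc]
    have h1 : eLpNorm (fun z => (starRingEnd ℂ) (w z)) 2 (weightMeasure ψ) =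
        eLpNorm w 2 (weightMeasure ψ) :=
      eLpNorm_congr_norm_ae (Filter.Eventually.of_forall fun z => by simp)
    have h2 : eLpNorm w 2 (weightMeasure ψ) = ENNReal.ofReal ‖w‖ := by
      rw [Lp.norm_def, ENNReal.ofReal_toReal (Lp.eLpNorm_ne_top w)]
    rw [h1, h2, ← ENNReal.ofReal_pow (norm_nonneg _), lintegral_areaMeasure,
      ← ofReal_integral_eq_lintegral_ofReal hfin' hnn, ← ENNReal.ofReal_mul hpi.le]
    refine ENNReal.ofReal_le_ofReal ?_
    calc ‖w‖ ^ 2 ≤ √(Real.pi⁻¹ * A) ^ 2 := by gcongr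
      _ = Real.pi⁻¹ * A := Real.sq_sqrt (by positivity)

end Hormander

/-! ### Entire functions of polynomial growth -/

/-- Liouville: Cauchy's estimates on circles of radius $r\to\infty$ kill every Taylor coefficient of
order above $n$. -/
theorem exists_coeff_of_polynomial_growth {h : ℂ → ℂ} (hh : Differentiable ℂ h) {C R : ℝ} {n : ℕ}
    (hb : ∀ z, R < ‖z‖ → ‖h z‖ ≤ C * ‖z‖ ^ n) :
    ∃ a : ℕ → ℂ, ∀ z, h z = ∑ k ∈ Finset.range (n + 1), a k * z ^ k := by
  have hvan : ∀ k, n < k → iteratedDeriv k h 0 = 0 := by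
    intro k hk
    have hle : ∀ r : ℝ, max R 0 < r →
        ‖iteratedDeriv k h 0‖ ≤ k.factorial * C * (1 / r ^ (k - n)) := by
      intro r hr
      have hr0 : 0 < r := (le_max_right _ _).trans_lt hr
      have h1 := Complex.norm_iteratedDeriv_le_of_forall_mem_sphere_norm_le (n := k) (c := (0 : ℂ))
        hr0 (hh.diffContOnCl) (C := C * r ^ n) (fun z hz => by
          have hz' : ‖z‖ = r := by simpa using hz
          have := hb z (by rw [hz']; exact (le_max_left _ _).trans_lt hr)
          rwa [hz'] at this)
      refine h1.trans (le_of_eq ?_)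
      have h2 : r ^ k = r ^ n * r ^ (k - n) := by rw [← pow_add]; congr 1; omega
      rw [h2]
      field_simp
    have hlim : Filter.Tendsto (fun r : ℝ => k.factorial * C * (1 / r ^ (k - n))) Filter.atTop
        (nhds (k.factorial * C * 0)) := by
      refine Filter.Tendsto.const_mul _ ?_
      simp only [one_div]
      exact tendsto_inv_atTop_zero.comp (Filter.tendsto_pow_atTop (by omega))
    rw [mul_zero] at hlim
    refine norm_le_zero_iff.1 (ge_of_tendsto hlim ?_)
    filter_upwards [Filter.eventually_gt_atTop (max R 0)] with r hr using hle r hr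
  refine ⟨fun k => (k.factorial : ℂ)⁻¹ * iteratedDeriv k h 0, fun z => ?_⟩
  have hs := Complex.hasSum_taylorSeries_of_entire hh 0 z
  have hs' := hasSum_sum_of_ne_finset_zero (L := .unconditional ℕ) (s := Finset.range (n + 1))
    (f := fun k : ℕ => ((k.factorial : ℂ)⁻¹ * (z - 0) ^ k) • iteratedDeriv k h 0) (fun k hk => by
      rw [hvan k (by simpa using hk), smul_zero])
  have hs2 : HasSum (fun k : ℕ => ((k.factorial : ℂ)⁻¹ * (z - 0) ^ k) • iteratedDeriv k h 0)
      (h z) := by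
    simpa [mul_smul, mul_assoc] using hs
  rw [hs2.unique hs']
  refine Finset.sum_congr rfl fun k _ => ?_
  rw [sub_zero, smul_eq_mul]
  ring

/-- With the strict inequality $R<|z|$ the exceptional set is open, so if nonempty it would have
positive measure. -/
theorem forall_norm_le_of_ae {h : ℂ → ℂ} (hh : Continuous h) {C R : ℝ} {n : ℕ}
    (hb : ∀ᵐ z : ℂ, R ≤ ‖z‖ → ‖h z‖ ≤ C * ‖z‖ ^ n) :
    ∀ z, R < ‖z‖ → ‖h z‖ ≤ C * ‖z‖ ^ n := by
  intro z hz
  by_contra hcon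
  push Not at hcon
  have hopen : IsOpen {z : ℂ | R < ‖z‖ ∧ C * ‖z‖ ^ n < ‖h z‖} :=
    (isOpen_lt continuous_const continuous_norm).inter
      (isOpen_lt (continuous_const.mul (continuous_norm.pow n)) hh.norm)
  refine (hopen.measure_pos volume ⟨z, hz, hcon⟩).ne' ?_
  refine measure_mono_null (fun w hw => ?_) (ae_iff.1 hb)
  simp only [Set.mem_ofPred_eq] at hw ⊢
  push Not
  exact ⟨hw.1.le, hw.2⟩

/-! ### Weighted spaces -/

section Spaces

variable {φ : ℂ → ℝ} {n : ℕ}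

theorem L2_add {u v : ℂ → ℂ} (hu : u ∈ L2 φ) (hv : v ∈ L2 φ) : u + v ∈ L2 φ := MemLp.add hu hv

theorem L2_const_smul {u : ℂ → ℂ} (hu : u ∈ L2 φ) (c : ℂ) : c • u ∈ L2 φ := MemLp.const_smul hu c

theorem L2_sub {u v : ℂ → ℂ} (hu : u ∈ L2 φ) (hv : v ∈ L2 φ) : u - v ∈ L2 φ := MemLp.sub hu hv

theorem L2_congr (hφ : Continuous φ) {u v : ℂ → ℂ} (hu : u ∈ L2 φ) (h : u =ᵐ[volume] v) :
    v ∈ L2 φ := by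
  refine MemLp.ae_eq ?_ hu
  rw [Filter.EventuallyEq, ae_weightMeasure hφ]
  exact h

theorem L2Trunc_add {u v : ℂ → ℂ} (hu : u ∈ L2Trunc φ n) (hv : v ∈ L2Trunc φ n) :
    u + v ∈ L2Trunc φ n := by
  obtain ⟨hu, C, R, hC⟩ := hu
  obtain ⟨hv, C', R', hC'⟩ := hv
  refine ⟨L2_add hu hv, C + C', max R R', ?_⟩
  filter_upwards [hC, hC'] with z h1 h2 hz
  rw [add_mul]
  exact (norm_add_le _ _).trans (add_le_add (h1 ((le_max_left _ _).trans hz))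
    (h2 ((le_max_right _ _).trans hz)))

theorem L2Trunc_const_smul {u : ℂ → ℂ} (hu : u ∈ L2Trunc φ n) (c : ℂ) : c • u ∈ L2Trunc φ n := by
  obtain ⟨hu, C, R, hC⟩ := hu
  refine ⟨L2_const_smul hu c, ‖c‖ * C, R, ?_⟩
  filter_upwards [hC] with z h1 hz
  rw [Pi.smul_apply, norm_smul, mul_assoc]
  exact mul_le_mul_of_nonneg_left (h1 hz) (norm_nonneg c)

theorem L2Trunc_sub {u v : ℂ → ℂ} (hu : u ∈ L2Trunc φ n) (hv : v ∈ L2Trunc φ n) :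
    u - v ∈ L2Trunc φ n := by
  have := L2Trunc_add hu (L2Trunc_const_smul hv (-1))
  rwa [neg_one_smul, ← sub_eq_add_neg] at this

theorem L2Trunc_congr (hφ : Continuous φ) {u v : ℂ → ℂ} (hu : u ∈ L2Trunc φ n)
    (h : u =ᵐ[volume] v) : v ∈ L2Trunc φ n := by
  obtain ⟨hu, C, R, hC⟩ := hu
  refine ⟨L2_congr hφ hu h, C, R, ?_⟩
  filter_upwards [hC, h] with z h1 h2
  rwa [← h2]

/-- The space `A²_{φ,n}` as a subspace of the space of functions. -/
def truncatedBergman (φ : ℂ → ℝ) (n : ℕ) : Submodule ℂ (ℂ → ℂ) where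
  carrier := A2Trunc φ n
  zero_mem' := ⟨⟨MemLp.zero', 0, 0, by simp⟩, MemLp.zero', differentiable_const 0⟩
  add_mem' h₁ h₂ := ⟨L2Trunc_add h₁.1 h₂.1, L2_add h₁.2.1 h₂.2.1, h₁.2.2.add h₂.2.2⟩
  smul_mem' c _ h := ⟨L2Trunc_const_smul h.1 c, L2_const_smul h.2.1 c, h.2.2.const_smul c⟩

/-- The growth condition leaves only polynomials of degree at most $n-1$. Finite dimension makes the
space complete, so orthogonal projection onto it exists. -/
theorem finiteDimensional_truncatedBergman : FiniteDimensional ℂ (truncatedBergman φ n) := by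
  have hle : truncatedBergman φ n ≤
      Submodule.span ℂ (Set.range fun (k : Fin (n - 1 + 1)) (z : ℂ) => z ^ (k : ℕ)) := by
    rintro h ⟨⟨-, C, R, hb⟩, -, hd⟩
    obtain ⟨a, ha⟩ := exists_coeff_of_polynomial_growth hd
      (forall_norm_le_of_ae hd.continuous hb)
    have h1 : h = ∑ k : Fin (n - 1 + 1), a k • fun z : ℂ => z ^ (k : ℕ) := by
      ext z
      rw [ha z, Finset.sum_range, Finset.sum_apply]
      rfl
    rw [h1]
    exact Submodule.sum_mem _ fun k _ =>
      Submodule.smul_mem _ _ (Submodule.subset_span ⟨k, rfl⟩)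
  have : FiniteDimensional ℂ
      (Submodule.span ℂ (Set.range fun (k : Fin (n - 1 + 1)) (z : ℂ) => z ^ (k : ℕ))) :=
    FiniteDimensional.span_of_finite ℂ (Set.finite_range _)
  exact Submodule.finiteDimensional_of_le hle

/-- The class in the Hilbert space `L²_φ` of an element of `L2 φ`. -/
noncomputable def toWeightedLp (u : ℂ → ℂ) (hu : u ∈ L2 φ) : Lp ℂ 2 (weightMeasure φ) :=
  MemLp.toLp (p := 2) (μ := weightMeasure φ) u hu

theorem toWeightedLp_add {u v : ℂ → ℂ} (hu : u ∈ L2 φ) (hv : v ∈ L2 φ) :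
    toWeightedLp (u + v) (L2_add hu hv) = toWeightedLp u hu + toWeightedLp v hv := rfl

theorem toWeightedLp_eq_iff (hφ : Continuous φ) {u v : ℂ → ℂ} (hu : u ∈ L2 φ) (hv : v ∈ L2 φ) :
    toWeightedLp u hu = toWeightedLp v hv ↔ u =ᵐ[volume] v := by
  have hu' : MemLp u 2 (weightMeasure φ) := hu
  have hv' : MemLp v 2 (weightMeasure φ) := hv
  change hu'.toLp u = hv'.toLp v ↔ _
  rw [MemLp.toLp_eq_toLp_iff, Filter.EventuallyEq, ae_weightMeasure hφ]
  rfl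

theorem norm_toWeightedLp_le_iff {u v : ℂ → ℂ} (hu : u ∈ L2 φ) (hv : v ∈ L2 φ) :
    ‖toWeightedLp u hu‖ ≤ ‖toWeightedLp v hv‖ ↔
      eLpNorm u 2 (weightMeasure φ) ≤ eLpNorm v 2 (weightMeasure φ) := by
  have hu' : MemLp u 2 (weightMeasure φ) := hu
  have hv' : MemLp v 2 (weightMeasure φ) := hv
  change ‖hu'.toLp u‖ ≤ ‖hv'.toLp v‖ ↔ _
  rw [Lp.norm_toLp, Lp.norm_toLp]
  exact ENNReal.toReal_le_toReal (MemLp.eLpNorm_ne_top hu) (MemLp.eLpNorm_ne_top hv)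

theorem inner_toWeightedLp (hφ : Continuous φ) {u v : ℂ → ℂ} (hu : u ∈ L2 φ) (hv : v ∈ L2 φ) :
    inner ℂ (toWeightedLp u hu) (toWeightedLp v hv) =
      Real.pi⁻¹ • ∫ z, Real.exp (-φ z) • ((starRingEnd ℂ) (u z) * v z) := by
  rw [← integral_weightMeasure hφ, L2.inner_def]
  refine integral_congr_ae ?_
  filter_upwards [MemLp.coeFn_toLp hu, MemLp.coeFn_toLp hv] with z h1 h2
  rw [toWeightedLp, toWeightedLp, h1, h2, RCLike.inner_apply, mul_comm]

/-- The inclusion of `A²_{φ,n}` into the Hilbert space `L²_φ`. -/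
noncomputable def truncatedBergmanToLp (φ : ℂ → ℝ) (n : ℕ) :
    truncatedBergman φ n →ₗ[ℂ] Lp ℂ 2 (weightMeasure φ) where
  toFun h := toWeightedLp (h : ℂ → ℂ) h.2.2.1
  map_add' _ _ := rfl
  map_smul' _ _ := rfl

/-- Pythagoras; this turns orthogonality into minimality. -/
theorem eLpNorm_le_add_of_orthogonal (hφ : Continuous φ) {w h : ℂ → ℂ} (hw : w ∈ L2 φ)
    (hh : h ∈ L2 φ) (horth : ∫ z, Real.exp (-φ z) • ((starRingEnd ℂ) (w z) * h z) = 0) :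
    eLpNorm w 2 (weightMeasure φ) ≤ eLpNorm (w + h) 2 (weightMeasure φ) := by
  have h0 : inner ℂ (toWeightedLp w hw) (toWeightedLp h hh) = 0 := by
    rw [inner_toWeightedLp hφ, horth, smul_zero]
  have h1 := norm_add_sq_eq_norm_sq_add_norm_sq_of_inner_eq_zero _ _ h0
  rw [← norm_toWeightedLp_le_iff hw (L2_add hw hh), toWeightedLp_add hw hh]
  nlinarith [norm_nonneg (toWeightedLp w hw + toWeightedLp h hh), norm_nonneg (toWeightedLp w hw),
    norm_nonneg (toWeightedLp h hh)]

end Spaces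

/-! ### The structure of the set of solutions -/

section Solutions

variable {F : ℂ → ℂ} {M R : ℝ}

theorem locallyIntegrable_of_bounded {u : ℂ → ℂ} (hu : AEStronglyMeasurable u volume) {C : ℝ}
    (hC : ∀ z, ‖u z‖ ≤ C) : LocallyIntegrable u :=
  (memLp_top_of_bound hu C (Filter.Eventually.of_forall hC)).locallyIntegrable le_top

theorem locallyIntegrable_cauchyTransform (hF : StronglyMeasurable F) (hM : ∀ z, ‖F z‖ ≤ M)
    (hR : ∀ z, R < ‖z‖ → F z = 0) : LocallyIntegrable (cauchyTransform F) := by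
  obtain ⟨C, hC⟩ := exists_norm_cauchyTransform_le hF hM hR
  exact locallyIntegrable_of_bounded (stronglyMeasurable_cauchyTransform hF).aestronglyMeasurable hC

/-- Weyl's lemma applied to the difference with the Cauchy transform. The decomposition yields
locally bounded representatives and permits $C^1$ test functions. -/
theorem exists_entire_of_isDbarSolution (hF : StronglyMeasurable F) (hM : ∀ z, ‖F z‖ ≤ M)
    (hR : ∀ z, R < ‖z‖ → F z = 0) {u : ℂ → ℂ} (hu : IsDbarSolution u F) :
    ∃ h : ℂ → ℂ, Differentiable ℂ h ∧ u =ᵐ[volume] fun z => cauchyTransform F z + h z := by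
  have hc := locallyIntegrable_cauchyTransform hF hM hR
  obtain ⟨h, hh, hae⟩ := exists_entire_ae_eq_of_integral_dbar_eq_zero (hu.1.sub hc)
    fun χ hχ hχc => by
      have hd : Continuous (dbar χ) := (hχ.of_le (by simp)).continuous_dbar
      simp only [Pi.sub_apply, sub_mul]
      rw [integral_sub (LocallyIntegrable.integrable_mul_testFunction hu.1 hd hχc.dbar)
        (LocallyIntegrable.integrable_mul_testFunction hc hd hχc.dbar), hu.2 χ hχ hχc,
        integral_cauchyTransform_mul_dbar hF hM hR (hχ.of_le (by simp)) hχc, sub_self]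
  refine ⟨h, hh, ?_⟩
  filter_upwards [hae] with z hz
  rw [← hz, Pi.sub_apply]
  ring

theorem integral_entire_mul_dbar_eq_zero {h : ℂ → ℂ} (hh : Differentiable ℂ h) {χ : ℂ → ℂ}
    (hχ : ContDiff ℝ 1 χ) (hc : HasCompactSupport χ) : ∫ z, h z * dbar χ z = 0 := by
  have hhs : ContDiff ℝ 1 h := (hh.contDiff (n := 1)).restrict_scalars ℝ
  have h1 : LocallyLipschitz (fun z => h z * χ z) := (hhs.mul hχ).locallyLipschitz
  rw [← h1.integral_dbar_eq_zero hc.mul_left]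
  congr 1
  ext z
  rw [dbar_mul (hhs.differentiable one_ne_zero z) (hχ.differentiable one_ne_zero z),
    dbar_eq_zero_of_differentiableAt (hh z)]
  ring

/-- The weak formulation of the `∂̄` equation, with continuously differentiable test functions. -/
theorem integral_mul_dbar_of_ae_eq (hF : StronglyMeasurable F) (hM : ∀ z, ‖F z‖ ≤ M)
    (hR : ∀ z, R < ‖z‖ → F z = 0) {u h : ℂ → ℂ} (hh : Differentiable ℂ h)
    (hu : u =ᵐ[volume] fun z => cauchyTransform F z + h z) {χ : ℂ → ℂ}
    (hχ : ContDiff ℝ 1 χ) (hc : HasCompactSupport χ) :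
    ∫ z, u z * dbar χ z = -∫ z, F z * χ z := by
  have hd := hχ.continuous_dbar
  have h1 : ∫ z, u z * dbar χ z = ∫ z, (cauchyTransform F z * dbar χ z + h z * dbar χ z) := by
    refine integral_congr_ae ?_
    filter_upwards [hu] with z hz
    rw [hz, add_mul]
  rw [h1, integral_add
    (LocallyIntegrable.integrable_mul_testFunction
      (locallyIntegrable_cauchyTransform hF hM hR) hd hc.dbar)
    (LocallyIntegrable.integrable_mul_testFunction
      (hh.continuous.locallyIntegrable) hd hc.dbar),
    integral_cauchyTransform_mul_dbar hF hM hR hχ hc, integral_entire_mul_dbar_eq_zero hh hχ hc,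
    add_zero]

theorem isDbarSolution_of_ae_eq (hF : StronglyMeasurable F) (hM : ∀ z, ‖F z‖ ≤ M)
    (hR : ∀ z, R < ‖z‖ → F z = 0) {u h : ℂ → ℂ} (hh : Differentiable ℂ h)
    (hu : u =ᵐ[volume] fun z => cauchyTransform F z + h z) : IsDbarSolution u F := by
  refine ⟨?_, fun χ hχ hc => integral_mul_dbar_of_ae_eq hF hM hR hh hu (hχ.of_le (by simp)) hc⟩
  have : LocallyIntegrable (fun z => cauchyTransform F z + h z) :=
    (locallyIntegrable_cauchyTransform hF hM hR).add hh.continuous.locallyIntegrable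
  exact this.congr hu.symm

theorem mem_L2Trunc_of_bounded {φ : ℂ → ℝ} {n : ℕ} (hconst : ∀ c : ℂ, (fun _ : ℂ => c) ∈ L2 φ)
    (hφ : Continuous φ) {u : ℂ → ℂ} (hu : AEStronglyMeasurable u volume) {C : ℝ}
    (hC : ∀ z, ‖u z‖ ≤ C) : u ∈ L2Trunc φ n := by
  have hC0 : 0 ≤ C := (norm_nonneg _).trans (hC 0)
  refine ⟨MemLp.mono (hconst (C : ℂ)) ((aestronglyMeasurable_weightMeasure_iff hφ).2 hu)
    (Filter.Eventually.of_forall fun z => ?_), C, 1, Filter.Eventually.of_forall fun z hz => ?_⟩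
  · rw [Complex.norm_real, Real.norm_of_nonneg hC0]
    exact hC z
  · exact (hC z).trans (le_mul_of_one_le_right hC0 (one_le_pow₀ hz))

end Solutions

/-! ### Minimal solutions -/

section Minimal

variable {φ : ℂ → ℝ} {n : ℕ} {f : ℂ → ℂ} {M R : ℝ}

theorem sub_mem_A2Trunc (hφ : Continuous φ) (hF : StronglyMeasurable f) (hM : ∀ z, ‖f z‖ ≤ M)
    (hR : ∀ z, R < ‖z‖ → f z = 0) {u v : ℂ → ℂ} (hu : u ∈ L2Trunc φ n) (hv : v ∈ L2Trunc φ n)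
    (hus : IsDbarSolution u f) (hvs : IsDbarSolution v f) :
    ∃ h ∈ A2Trunc φ n, u =ᵐ[volume] v + h := by
  obtain ⟨h₁, hh₁, hu₁⟩ := exists_entire_of_isDbarSolution hF hM hR hus
  obtain ⟨h₂, hh₂, hv₂⟩ := exists_entire_of_isDbarSolution hF hM hR hvs
  have hae : u - v =ᵐ[volume] h₁ - h₂ := by
    filter_upwards [hu₁, hv₂] with z h1 h2
    rw [Pi.sub_apply, Pi.sub_apply, h1, h2]
    ring
  have hT := L2Trunc_congr hφ (L2Trunc_sub hu hv) hae
  refine ⟨h₁ - h₂, ⟨hT, hT.1, hh₁.sub hh₂⟩, ?_⟩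
  filter_upwards [hae] with z hz
  rw [Pi.add_apply, ← hz, Pi.sub_apply]
  ring

theorem isDbarSolution_add (hF : StronglyMeasurable f) (hM : ∀ z, ‖f z‖ ≤ M)
    (hR : ∀ z, R < ‖z‖ → f z = 0) {u h : ℂ → ℂ} (hu : IsDbarSolution u f)
    (hh : Differentiable ℂ h) : IsDbarSolution (u + h) f := by
  obtain ⟨h₁, hh₁, hu₁⟩ := exists_entire_of_isDbarSolution hF hM hR hu
  refine isDbarSolution_of_ae_eq hF hM hR (hh₁.add hh) ?_
  filter_upwards [hu₁] with z hz
  rw [Pi.add_apply, hz, Pi.add_apply, add_assoc]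

/-- Subtract from one solution its orthogonal projection onto $A^2_{\phi,n}$: all other solutions in
$L^2_{\phi,n}$ arise by subtracting some element of that space. -/
theorem exists_isMinimalSolution (hφ : Continuous φ) (hF : StronglyMeasurable f)
    (hM : ∀ z, ‖f z‖ ≤ M) (hR : ∀ z, R < ‖z‖ → f z = 0) {u₀ : ℂ → ℂ} (hu₀ : u₀ ∈ L2Trunc φ n)
    (hs : IsDbarSolution u₀ f) : ∃ u, IsMinimalSolution φ n f u := by
  have := finiteDimensional_truncatedBergman (φ := φ) (n := n)
  have hcomp : IsComplete (LinearMap.range (truncatedBergmanToLp φ n) :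
      Set (Lp ℂ 2 (weightMeasure φ))) := Submodule.complete_of_finiteDimensional _
  obtain ⟨_, ⟨p, rfl⟩, hp⟩ := Submodule.exists_norm_eq_iInf_of_complete_subspace _ hcomp
    (toWeightedLp u₀ hu₀.1)
  have hneg : Differentiable ℂ (-(p : ℂ → ℂ)) := p.2.2.2.neg
  refine ⟨u₀ - (p : ℂ → ℂ), ⟨L2Trunc_sub hu₀ p.2.1, ?_⟩, fun v hv hvs => ?_⟩
  · rw [sub_eq_add_neg]
    exact isDbarSolution_add hF hM hR hs hneg
  · obtain ⟨h, hh, hae⟩ := sub_mem_A2Trunc hφ hF hM hR hu₀ hv hs hvs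
    have hle := hp.trans_le (ciInf_le (f := fun w : LinearMap.range (truncatedBergmanToLp φ n) =>
      ‖toWeightedLp u₀ hu₀.1 - w‖) ⟨0, by rintro _ ⟨w, rfl⟩; exact norm_nonneg _⟩
      ⟨truncatedBergmanToLp φ n ⟨h, hh⟩, LinearMap.mem_range_self _ _⟩)
    have e2 : toWeightedLp (u₀ - h) (L2_sub hu₀.1 hh.2.1) = toWeightedLp v hv.1 := by
      rw [toWeightedLp_eq_iff hφ]
      filter_upwards [hae] with z hz
      rw [Pi.sub_apply, hz, Pi.add_apply]
      ring
    refine (norm_toWeightedLp_le_iff (L2_sub hu₀.1 p.2.2.1) hv.1).1 ?_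
    rw [← e2]
    exact hle

/-- Subtracting an element of $A^2_{\phi,n}$ gives another admissible solution, so $0$ is a nearest
point to $u$ in that space. -/
theorem IsMinimalSolution.orthogonal (hφ : Continuous φ) (hF : StronglyMeasurable f)
    (hM : ∀ z, ‖f z‖ ≤ M) (hR : ∀ z, R < ‖z‖ → f z = 0) {u h : ℂ → ℂ}
    (hu : IsMinimalSolution φ n f u) (hh : h ∈ A2Trunc φ n) :
    ∫ z, Real.exp (-φ z) • ((starRingEnd ℂ) (u z) * h z) = 0 := by
  obtain ⟨⟨huT, hus⟩, hmin⟩ := hu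
  have hiInf : ‖toWeightedLp u huT.1 - 0‖ =
      ⨅ w : LinearMap.range (truncatedBergmanToLp φ n), ‖toWeightedLp u huT.1 - w‖ := by
    refine le_antisymm (le_ciInf ?_) ?_
    · rintro ⟨_, p, rfl⟩
      have hneg : Differentiable ℂ (-(p : ℂ → ℂ)) := p.2.2.2.neg
      have h1 := hmin (u - (p : ℂ → ℂ)) (L2Trunc_sub huT p.2.1)
        (by rw [sub_eq_add_neg]; exact isDbarSolution_add hF hM hR hus hneg)
      rw [sub_zero]
      exact (norm_toWeightedLp_le_iff huT.1 (L2_sub huT.1 p.2.2.1)).2 h1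
    · exact ciInf_le (f := fun w : LinearMap.range (truncatedBergmanToLp φ n) =>
        ‖toWeightedLp u huT.1 - w‖) ⟨0, by rintro _ ⟨w, rfl⟩; exact norm_nonneg _⟩ 0
  have h1 := (Submodule.norm_eq_iInf_iff_inner_eq_zero _ (Submodule.zero_mem _)).1 hiInf
    (truncatedBergmanToLp φ n ⟨h, hh⟩) (LinearMap.mem_range_self _ _)
  rw [sub_zero] at h1
  have h2 := (inner_toWeightedLp hφ huT.1 hh.2.1).symm.trans h1
  exact (smul_eq_zero.1 h2).resolve_left (inv_ne_zero Real.pi_ne_zero)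

/-- The difference of two minimal solutions lies in $A^2_{\phi,n}$ and is orthogonal to it, hence to
itself. -/
theorem IsMinimalSolution.ae_unique (hφ : Continuous φ) (hF : StronglyMeasurable f)
    (hM : ∀ z, ‖f z‖ ≤ M) (hR : ∀ z, R < ‖z‖ → f z = 0) {u v : ℂ → ℂ}
    (hu : IsMinimalSolution φ n f u) (hv : IsMinimalSolution φ n f v) :
    ∀ᵐ z : ℂ, u z = v z := by
  have huL : u ∈ L2 φ := hu.1.1.1
  have hvL : v ∈ L2 φ := hv.1.1.1
  obtain ⟨h, hh, hae⟩ := sub_mem_A2Trunc hφ hF hM hR hu.1.1 hv.1.1 hu.1.2 hv.1.2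
  have h1 := hu.orthogonal hφ hF hM hR hh
  have h2 := hv.orthogonal hφ hF hM hR hh
  have hhL : h ∈ L2 φ := hh.2.1
  have i1 : inner ℂ (toWeightedLp u huL) (toWeightedLp h hhL) = 0 := by
    rw [inner_toWeightedLp hφ, h1, smul_zero]
  have i2 : inner ℂ (toWeightedLp v hvL) (toWeightedLp h hhL) = 0 := by
    rw [inner_toWeightedLp hφ, h2, smul_zero]
  have e : toWeightedLp u huL = toWeightedLp v hvL + toWeightedLp h hhL := by
    rw [← toWeightedLp_add hvL hhL, toWeightedLp_eq_iff hφ]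
    exact hae
  rw [e, inner_add_left, i2, zero_add, inner_self_eq_zero] at i1
  rw [i1, add_zero, toWeightedLp_eq_iff hφ] at e
  exact e

end Minimal

/-! ### Comparison of weights -/

section Comparison

variable {φ₁ φ₂ : ℂ → ℝ} {c : ℝ}

theorem lintegral_weight_le (h : ∀ z, φ₁ z ≤ φ₂ z + c) (u : ℂ → ℂ) :
    ∫⁻ z, ENNReal.ofReal (‖u z‖ ^ 2 * Real.exp (-φ₂ z)) ∂areaMeasure ≤
      ENNReal.ofReal (Real.exp c) *
        ∫⁻ z, ENNReal.ofReal (‖u z‖ ^ 2 * Real.exp (-φ₁ z)) ∂areaMeasure := by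
  rw [← lintegral_const_mul' _ _ ENNReal.ofReal_ne_top]
  refine lintegral_mono fun z => ?_
  rw [← ENNReal.ofReal_mul (Real.exp_pos c).le]
  refine ENNReal.ofReal_le_ofReal ?_
  rw [mul_left_comm, ← Real.exp_add]
  gcongr
  linarith [h z]

theorem L2_subset_L2 (h₁ : Continuous φ₁) (h₂ : Continuous φ₂) (h : ∀ z, φ₁ z ≤ φ₂ z + c) :
    L2 φ₁ ⊆ L2 φ₂ := by
  intro u hu
  rw [mem_L2_iff h₁] at hu
  rw [mem_L2_iff h₂]
  exact ⟨hu.1, (lintegral_weight_le h u).trans_lt (ENNReal.mul_lt_top ENNReal.ofReal_lt_top hu.2)⟩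

theorem locallyIntegrable_of_mem_L2 (hφ : Continuous φ₁) {u : ℂ → ℂ} (hu : u ∈ L2 φ₁) :
    LocallyIntegrable u := by
  have := isFiniteMeasureOnCompacts_weightMeasure hφ
  rw [locallyIntegrable_iff]
  intro K hK
  have hu' : MemLp u 2 (weightMeasure φ₁) := hu
  have : IsFiniteMeasure ((weightMeasure φ₁).restrict K) := ⟨by
    rw [Measure.restrict_apply_univ]; exact hK.measure_lt_top⟩
  have h1 : Integrable u ((weightMeasure φ₁).restrict K) :=
    (hu'.restrict K).integrable one_le_two
  rw [weightMeasure, restrict_withDensity hK.measurableSet,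
    integrable_withDensity_iff_integrable_smul' (measurable_weight hφ)
      (Filter.Eventually.of_forall fun _ => ENNReal.ofReal_lt_top), areaMeasure,
    Measure.restrict_smul, integrable_smul_measure (by simpa using Real.pi_pos)
      ENNReal.ofReal_ne_top] at h1
  have h2 : IntegrableOn (fun z => (Real.exp (φ₁ z) : ℂ) *
      ((ENNReal.ofReal (Real.exp (-φ₁ z))).toReal • u z)) K :=
    IntegrableOn.continuousOn_mul
      (Complex.continuous_ofReal.comp hφ.rexp).continuousOn h1 hK
  refine h2.congr_fun (fun z _ => ?_) hK.measurableSet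
  simp only
  rw [ENNReal.toReal_ofReal (Real.exp_pos _).le, Complex.real_smul, ← mul_assoc,
    ← Complex.ofReal_mul, ← Real.exp_add]
  simp

end Comparison

/-! ### Functions which are locally constant off a compact set -/

section LocallyConstant

variable {S : Set ℂ} {ϱ : ℂ → ℝ}

theorem isPreconnected_norm_gt (R : ℝ) : IsPreconnected {z : ℂ | R < ‖z‖} := by
  have h : {z : ℂ | R < ‖z‖} =
      (fun p : ℝ × ℝ => (p.1 : ℂ) * unitVector p.2) '' (Set.Ioi R ×ˢ Set.univ) := by
    ext z
    constructor
    · intro hz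
      exact ⟨(‖z‖, Complex.arg z), ⟨hz, trivial⟩, by
        simp [unitVector]⟩
    · rintro ⟨⟨r, θ⟩, ⟨hr, -⟩, rfl⟩
      have hr' : R < r := hr
      simp only [Set.mem_ofPred_eq, norm_mul, norm_unitVector, mul_one, Complex.norm_real,
        Real.norm_eq_abs]
      exact hr'.trans_le (le_abs_self r)
  rw [h]
  refine (isPreconnected_Ioi.prod isPreconnected_univ).image _ (Continuous.continuousOn ?_)
  have := continuous_unitVector
  fun_prop

theorem fderiv_eq_zero_of_locally_constant (h : ∀ z ∉ S, ∀ᶠ w in nhds z, ϱ w = ϱ z) {z : ℂ}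
    (hz : z ∉ S) : fderiv ℝ ϱ z = 0 := by
  have h1 : ϱ =ᶠ[nhds z] fun _ => ϱ z := h z hz
  rw [h1.fderiv_eq]
  simp

/-- Outside a large disc the complement is connected, so $\varrho$ is a single constant there;
inside, it is bounded by continuity. Hence factors $e^{\pm\varrho}$ change none of the weighted
spaces. -/
theorem exists_abs_le_of_locally_constant (hS : IsCompact S) (hϱ : ContDiff ℝ 1 ϱ)
    (h : ∀ z ∉ S, ∀ᶠ w in nhds z, ϱ w = ϱ z) : ∃ B, ∀ z, |ϱ z| ≤ B := by
  obtain ⟨R, hR⟩ := hS.isBounded.exists_norm_le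
  set R' := max R 0 with hR'
  have hout : ∀ z : ℂ, R' < ‖z‖ → z ∉ S := fun z hz hzS =>
    absurd (hR z hzS) (not_le.2 ((le_max_left _ _).trans_lt hz))
  obtain ⟨B, hB⟩ := (isCompact_closedBall (0 : ℂ) R').exists_bound_of_continuousOn
    hϱ.continuous.continuousOn
  have hz₀ : R' < ‖((R' + 1 : ℝ) : ℂ)‖ := by
    rw [Complex.norm_real, Real.norm_eq_abs]
    exact (lt_add_one R').trans_le (le_abs_self _)
  refine ⟨max B |ϱ ((R' + 1 : ℝ) : ℂ)|, fun z => ?_⟩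
  by_cases hz : z ∈ Metric.closedBall (0 : ℂ) R'
  · exact (hB z hz).trans (le_max_left _ _)
  · have hz' : R' < ‖z‖ := by simpa using hz
    have heq := (isOpen_lt continuous_const continuous_norm).is_const_of_fderiv_eq_zero (𝕜 := ℝ)
      (isPreconnected_norm_gt R')
      (hϱ.differentiable one_ne_zero).differentiableOn
      (fun w hw => fderiv_eq_zero_of_locally_constant h (hout w hw)) hz' hz₀
    rw [heq]
    exact le_max_right _ _

end LocallyConstant

/-! ### The weighted estimate for the minimal solution -/

section Estimate

/-- Equivalent, after the triangle inequality, to $(\kappa|a|-(1-\kappa)|b|)^2\ge0$. The weights are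
chosen so that $|b|^2\lesssim\kappa^2$ contributes a factor $\kappa<1$. -/
theorem norm_add_sq_le_of_lt_one {κ : ℝ} (hκ0 : 0 < κ) (hκ1 : κ < 1) (a b : ℂ) :
    ‖a + b‖ ^ 2 ≤ ‖a‖ ^ 2 / (1 - κ) + ‖b‖ ^ 2 / κ := by
  have h1 : 0 < 1 - κ := by linarith
  have h2 : ‖a + b‖ ^ 2 ≤ (‖a‖ + ‖b‖) ^ 2 := by gcongr; exact norm_add_le _ _
  refine h2.trans ?_
  rw [div_add_div _ _ h1.ne' hκ0.ne', le_div_iff₀ (by positivity)]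
  nlinarith [sq_nonneg (κ * ‖a‖ - (1 - κ) * ‖b‖)]

/-- Absorbing a small multiple of a finite quantity. -/
theorem le_mul_of_le_add_mul {A B : ENNReal} (hA : A ≠ ⊤) {c κ : ℝ} (hc : 0 < c) (hκ0 : 0 < κ)
    (hκ1 : κ < 1) (h : A ≤ ENNReal.ofReal (c / (1 - κ)) * B + ENNReal.ofReal κ * A) :
    A ≤ ENNReal.ofReal (c / (1 - κ) ^ 2) * B := by
  have h1 : 0 < 1 - κ := by linarith
  by_cases hB : B = ⊤
  · rw [hB, ENNReal.mul_top (by simp; positivity)]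
    exact le_top
  lift A to NNReal using hA
  lift B to NNReal using hB
  have hpos : (0 : ℝ) ≤ c / (1 - κ) := by positivity
  have h' : (A : ℝ) ≤ c / (1 - κ) * B + κ * A := by
    rw [← ENNReal.ofReal_coe_nnreal, ← ENNReal.ofReal_coe_nnreal (p := B),
      ← ENNReal.ofReal_mul hpos, ← ENNReal.ofReal_mul hκ0.le,
      ← ENNReal.ofReal_add (by positivity) (by positivity)] at h
    exact (ENNReal.ofReal_le_ofReal_iff (by positivity)).1 h
  rw [← ENNReal.ofReal_coe_nnreal, ← ENNReal.ofReal_coe_nnreal (p := B),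
    ← ENNReal.ofReal_mul (by positivity)]
  refine ENNReal.ofReal_le_ofReal ?_
  have h2 : (1 - κ) * A ≤ c / (1 - κ) * B := by linarith
  have h3 : (A : ℝ) ≤ (c / (1 - κ) * B) / (1 - κ) := by
    rw [le_div_iff₀ h1]; linarith
  refine h3.trans (le_of_eq ?_)
  field_simp

variable {φ ϱ : ℂ → ℝ} {n : ℕ} {f : ℂ → ℂ} {M R : ℝ}

theorem mul_exp_mem_L2Trunc (hϱ : Continuous ϱ) {B : ℝ}
    (hB : ∀ z, |ϱ z| ≤ B) {u : ℂ → ℂ} (hu : u ∈ L2Trunc φ n) :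
    (fun z => u z * (Real.exp (ϱ z) : ℂ)) ∈ L2Trunc φ n := by
  obtain ⟨hu, C, R, hC⟩ := hu
  have hle : ∀ z, ‖u z * (Real.exp (ϱ z) : ℂ)‖ ≤ Real.exp B * ‖u z‖ := by
    intro z
    rw [norm_mul, Complex.norm_real, Real.norm_of_nonneg (Real.exp_pos _).le, mul_comm]
    gcongr
    exact (le_abs_self _).trans (hB z)
  refine ⟨?_, Real.exp B * C, R, ?_⟩
  · have hu' : MemLp u 2 (weightMeasure φ) := hu
    refine MemLp.of_le_mul (c := Real.exp B) hu' ?_ (Filter.Eventually.of_forall hle)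
    exact hu'.aestronglyMeasurable.mul
      (Complex.continuous_ofReal.comp hϱ.rexp).aestronglyMeasurable
  · filter_upwards [hC] with z hz hzR
    rw [mul_assoc]
    exact (hle z).trans (by gcongr; exact hz hzR)

/-- The weak product rule, obtained by testing the equation for $u$ against $\chi e^{\varrho}$. This
function is only known to be $C^1$, hence the weak equation for $C^1$ test functions. -/
theorem isDbarSolution_mul_exp (hF : StronglyMeasurable f) (hM : ∀ z, ‖f z‖ ≤ M)
    (hR : ∀ z, R < ‖z‖ → f z = 0) (hϱ : ContDiff ℝ 1 ϱ) {u : ℂ → ℂ} (hu : IsDbarSolution u f) :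
    IsDbarSolution (fun z => u z * (Real.exp (ϱ z) : ℂ))
      (fun z => (f z + u z * dbar (fun w => (ϱ w : ℂ)) z) * (Real.exp (ϱ z) : ℂ)) := by
  obtain ⟨h, hh, hae⟩ := exists_entire_of_isDbarSolution hF hM hR hu
  have hexp : Continuous fun z => (Real.exp (ϱ z) : ℂ) := (contDiff_exp_ofReal hϱ).continuous
  refine ⟨?_, fun χ hχ hc => ?_⟩
  · rw [locallyIntegrable_iff]
    intro K hK
    exact (hu.1.integrableOn_isCompact hK).mul_continuousOn hexp.continuousOn hK
  · have hχ1 : ContDiff ℝ 1 χ := hχ.of_le (by simp)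
    have hϱc : ContDiff ℝ 1 (fun w => (ϱ w : ℂ)) := Complex.ofRealCLM.contDiff.comp hϱ
    have hwk := integral_mul_dbar_of_ae_eq hF hM hR hh hae
      (hχ1.mul (contDiff_exp_ofReal hϱ)) hc.mul_right
    have hdb : ∀ z, dbar (fun z => χ z * (Real.exp (ϱ z) : ℂ)) z =
        dbar χ z * (Real.exp (ϱ z) : ℂ) +
          χ z * ((Real.exp (ϱ z) : ℂ) * dbar (fun w => (ϱ w : ℂ)) z) := by
      intro z
      rw [dbar_mul (hχ1.differentiable one_ne_zero z)
        ((contDiff_exp_ofReal hϱ).differentiable one_ne_zero z),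
        dbar_exp (hϱ.differentiable one_ne_zero z)]
    have hi1 : Integrable fun z => u z * (dbar χ z * (Real.exp (ϱ z) : ℂ)) :=
      LocallyIntegrable.integrable_mul_testFunction hu.1 (hχ1.continuous_dbar.mul hexp)
        hc.dbar.mul_right
    have hi2 : Integrable fun z =>
        u z * (χ z * ((Real.exp (ϱ z) : ℂ) * dbar (fun w => (ϱ w : ℂ)) z)) :=
      LocallyIntegrable.integrable_mul_testFunction hu.1
        (hχ.continuous.mul (hexp.mul hϱc.continuous_dbar)) hc.mul_right
    have hi3 : Integrable fun z => f z * (χ z * (Real.exp (ϱ z) : ℂ)) :=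
      LocallyIntegrable.integrable_mul_testFunction
        (locallyIntegrable_of_bounded hF.aestronglyMeasurable hM)
        (hχ.continuous.mul hexp) hc.mul_right
    have e1 : ∫ z, u z * dbar (fun z => χ z * (Real.exp (ϱ z) : ℂ)) z =
        (∫ z, u z * (dbar χ z * (Real.exp (ϱ z) : ℂ))) +
          ∫ z, u z * (χ z * ((Real.exp (ϱ z) : ℂ) * dbar (fun w => (ϱ w : ℂ)) z)) := by
      rw [← integral_add hi1 hi2]
      congr 1; ext z
      rw [hdb, mul_add]
    have e2 : ∫ z, (f z + u z * dbar (fun w => (ϱ w : ℂ)) z) * (Real.exp (ϱ z) : ℂ) * χ z =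
        (∫ z, f z * (χ z * (Real.exp (ϱ z) : ℂ))) +
          ∫ z, u z * (χ z * ((Real.exp (ϱ z) : ℂ) * dbar (fun w => (ϱ w : ℂ)) z)) := by
      rw [← integral_add hi3 hi2]
      congr 1; ext z
      ring
    have e3 : ∫ z, u z * (Real.exp (ϱ z) : ℂ) * dbar χ z =
        ∫ z, u z * (dbar χ z * (Real.exp (ϱ z) : ℂ)) := by
      congr 1; ext z; ring
    have hwk' : ∫ z, u z * dbar (fun z => χ z * (Real.exp (ϱ z) : ℂ)) z =
      -∫ z, f z * (χ z * (Real.exp (ϱ z) : ℂ)) := hwk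
    rw [e3, e2, neg_add, ← hwk', e1]
    ring

theorem isDbarSolution_congr {u v f g : ℂ → ℂ} (hu : IsDbarSolution u f)
    (huv : u =ᵐ[volume] v) (hfg : f =ᵐ[volume] g) : IsDbarSolution v g := by
  refine ⟨hu.1.congr huv, fun χ hχ hc => ?_⟩
  have e1 : ∫ z, v z * dbar χ z = ∫ z, u z * dbar χ z :=
    integral_congr_ae (by filter_upwards [huv] with z hz; rw [hz])
  have e2 : ∫ z, g z * χ z = ∫ z, f z * χ z :=
    integral_congr_ae (by filter_upwards [hfg] with z hz; rw [hz])
  rw [e1, e2, hu.2 χ hχ hc]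

end Estimate

theorem exists_bound_on_closedBall {f : ℂ → ℂ} {M R : ℝ} (hF : StronglyMeasurable f)
    (hM : ∀ z, ‖f z‖ ≤ M) (hR : ∀ z, R < ‖z‖ → f z = 0) {h : ℂ → ℂ} (hh : Continuous h) (r : ℝ) :
    ∃ C, ∀ z, ‖z‖ ≤ r → ‖cauchyTransform f z + h z‖ ≤ C := by
  obtain ⟨C₁, hC₁⟩ := exists_norm_cauchyTransform_le hF hM hR
  obtain ⟨C₂, hC₂⟩ := (isCompact_closedBall (0 : ℂ) r).exists_bound_of_continuousOn
    hh.continuousOn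
  refine ⟨C₁ + C₂, fun z hz => ?_⟩
  exact (norm_add_le _ _).trans (add_le_add (hC₁ z) (hC₂ z (by simpa using hz)))

theorem dbar_ofReal_eq_zero_of_locally_constant {S : Set ℂ} {ϱ : ℂ → ℝ} (hϱ : ContDiff ℝ 1 ϱ)
    (h4 : ∀ z ∉ S, ∀ᶠ w in nhds z, ϱ w = ϱ z) {z : ℂ} (hz : z ∉ S) :
    dbar (fun w => (ϱ w : ℂ)) z = 0 := by
  have h := fderiv_eq_zero_of_locally_constant h4 hz
  simp [dbar, fderiv_ofReal_comp (hϱ.differentiable one_ne_zero z), h]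

/-- The estimate which remains to be absorbed: `u` is orthogonal to `A²_{φ,n}`, so `u e^ϱ` has
smaller norm than the Hörmander solution with the same `∂̄`-derivative. -/
theorem IsMinimalSolution.lintegral_le_of_hormander {S : Set ℂ} (hS : IsCompact S)
    {φ φhat ϱ : ℂ → ℝ} (hφ : IsC11 φ) (hφhat : IsC11 φhat) (hϱ : IsC11 ϱ) {n : ℕ} {α : ℝ}
    (h1const : ∀ c : ℂ, (fun _ : ℂ => c) ∈ L2 φhat) (h1le : ∀ z : ℂ, φhat z ≤ φ z + α)
    (h2 : A2 φhat ⊆ A2Trunc φ n) (h3 : IsStrictlySubharmonic (fun z => φhat z + ϱ z))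
    (h4 : ∀ z ∉ S, ∀ᶠ w in nhds z, ϱ w = ϱ z) {f : ℂ → ℂ} (hf : Continuous f)
    (hfS : ∀ z ∉ S, f z = 0) {u : ℂ → ℂ} (hu : IsMinimalSolution φ n f u)
    (hfin : ∫⁻ z, ENNReal.ofReal
      (‖(f z + u z * dbar (fun w => (ϱ w : ℂ)) z) * (Real.exp (ϱ z) : ℂ)‖ ^ 2 *
        (Real.exp (-(φhat z + ϱ z)) / normLaplacian (fun z => φhat z + ϱ z) z))
        ∂areaMeasure < ⊤) :
    ∫⁻ z, ENNReal.ofReal (‖u z‖ ^ 2 * Real.exp (ϱ z - φ z)) ∂areaMeasure ≤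
      ENNReal.ofReal (Real.exp α) * ∫⁻ z, ENNReal.ofReal
        (‖(f z + u z * dbar (fun w => (ϱ w : ℂ)) z) * (Real.exp (ϱ z) : ℂ)‖ ^ 2 *
          (Real.exp (-(φhat z + ϱ z)) / normLaplacian (fun z => φhat z + ϱ z) z))
          ∂areaMeasure := by
  obtain ⟨b, hb⟩ := exists_abs_le_of_locally_constant hS hϱ.1 h4
  have hfc : HasCompactSupport f := HasCompactSupport.intro hS fun z hz => hfS z hz
  obtain ⟨M, hM⟩ := hfc.exists_bound_of_continuous hf
  obtain ⟨R, hRS⟩ := hS.isBounded.exists_norm_le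
  have hout : ∀ z : ℂ, R < ‖z‖ → z ∉ S := fun z hz hzS => absurd (hRS z hzS) (not_le.2 hz)
  have hR : ∀ z, R < ‖z‖ → f z = 0 := fun z hz => hfS z (hout z hz)
  have hfm : StronglyMeasurable f := hf.stronglyMeasurable
  have hφc := hφ.1.continuous
  have hφhatc := hφhat.1.continuous
  have hϱc := hϱ.1.continuous
  have hψ : IsC11 (fun z => φhat z + ϱ z) := hφhat.add hϱ
  have hd : Continuous (dbar fun w => (ϱ w : ℂ)) :=
    (Complex.ofRealCLM.contDiff.comp hϱ.1 : ContDiff ℝ 1 fun w => (ϱ w : ℂ)).continuous_dbar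
  have hexp : Continuous fun z => (Real.exp (ϱ z) : ℂ) := (contDiff_exp_ofReal hϱ.1).continuous
  obtain ⟨⟨huT, hus⟩, -⟩ := id hu
  obtain ⟨h, hh, hae⟩ := exists_entire_of_isDbarSolution hfm hM hR hus
  -- Replacing $u$ by its representative makes the right-hand side bounded, strongly measurable and
  -- zero off a disc everywhere, so the Cauchy transform theory applies to it.
  set F : ℂ → ℂ := fun z =>
    (f z + (cauchyTransform f z + h z) * dbar (fun w => (ϱ w : ℂ)) z) * (Real.exp (ϱ z) : ℂ)
    with hFdef
  have hFm : StronglyMeasurable F :=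
    (hfm.add (((stronglyMeasurable_cauchyTransform hfm).add
      hh.continuous.stronglyMeasurable).mul hd.stronglyMeasurable)).mul hexp.stronglyMeasurable
  have hF0 : ∀ z, R < ‖z‖ → F z = 0 := by
    intro z hz
    simp only [hFdef]
    rw [hR z hz, dbar_ofReal_eq_zero_of_locally_constant hϱ.1 h4 (hout z hz)]
    simp
  obtain ⟨M', hM'⟩ : ∃ M', ∀ z, ‖F z‖ ≤ M' := by
    obtain ⟨C, hC⟩ := exists_bound_on_closedBall hfm hM hR hh.continuous R
    obtain ⟨C', hC'⟩ := (isCompact_closedBall (0 : ℂ) R).exists_bound_of_continuousOn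
      hd.continuousOn
    have hM0 : 0 ≤ M := (norm_nonneg _).trans (hM 0)
    refine ⟨(M + |C| * |C'|) * Real.exp b, fun z => ?_⟩
    by_cases hz : ‖z‖ ≤ R
    · simp only [hFdef, norm_mul, Complex.norm_real]
      rw [Real.norm_of_nonneg (Real.exp_pos _).le]
      have h6 := norm_add_le (f z) ((cauchyTransform f z + h z) * dbar (fun w => (ϱ w : ℂ)) z)
      rw [norm_mul] at h6
      gcongr
      · refine h6.trans (add_le_add (hM z) (mul_le_mul ((hC z hz).trans (le_abs_self C))
          ((hC' z (by simpa using hz)).trans (le_abs_self C')) (norm_nonneg _) (abs_nonneg _)))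
      · exact (le_abs_self _).trans (hb z)
    · rw [hF0 z (not_le.1 hz), norm_zero]
      positivity
  have hFae : (fun z => (f z + u z * dbar (fun w => (ϱ w : ℂ)) z) * (Real.exp (ϱ z) : ℂ))
      =ᵐ[volume] F := by
    filter_upwards [hae] with z hz
    rw [hz]
  set w : ℂ → ℂ := fun z => u z * (Real.exp (ϱ z) : ℂ) with hw
  have hwT : w ∈ L2Trunc φ n := mul_exp_mem_L2Trunc hϱc hb huT
  have hws : IsDbarSolution w F :=
    isDbarSolution_congr (isDbarSolution_mul_exp hfm hM hR hϱ.1 hus) (ae_eq_refl _) hFae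
  have hJF : ∫⁻ z, ENNReal.ofReal
      (‖(f z + u z * dbar (fun w => (ϱ w : ℂ)) z) * (Real.exp (ϱ z) : ℂ)‖ ^ 2 *
        (Real.exp (-(φhat z + ϱ z)) / normLaplacian (fun z => φhat z + ϱ z) z))
        ∂areaMeasure = ∫⁻ z, ENNReal.ofReal (‖F z‖ ^ 2 *
          (Real.exp (-(φhat z + ϱ z)) / normLaplacian (fun z => φhat z + ϱ z) z))
        ∂areaMeasure := by
    refine lintegral_congr_ae (areaMeasure_ae_iff.2 ?_)
    filter_upwards [hFae] with z hz
    rw [hz]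
  rw [hJF] at hfin ⊢
  have hFi : LocallyIntegrable F := locallyIntegrable_of_bounded hFm.aestronglyMeasurable hM'
  obtain ⟨v, hvL, hvweak, hvle⟩ := exists_weighted_dbar_solution hψ h3 hFi hfin
  have hvs : IsDbarSolution v F :=
    ⟨locallyIntegrable_of_mem_L2 hψ.1.continuous hvL, hvweak⟩
  -- $v$ is a bounded Cauchy transform plus an entire $g$. As $\varrho$ is bounded, $v\in
  -- L^2_{\widehat\phi}$, so $g\in A^2_{\widehat\phi}\subset A^2_{\phi,n}$. This is where assumption
  -- 2 enters.
  have hvT : v ∈ L2Trunc φ n := by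
    obtain ⟨g, hg, hvg⟩ := exists_entire_of_isDbarSolution hFm hM' hF0 hvs
    obtain ⟨C, hC⟩ := exists_norm_cauchyTransform_le hFm hM' hF0
    have hcm := (stronglyMeasurable_cauchyTransform hFm).aestronglyMeasurable (μ := volume)
    have hv' : v ∈ L2 φhat := L2_subset_L2 (c := b) hψ.1.continuous hφhatc
      (fun z => by linarith [(le_abs_self (ϱ z)).trans (hb z)]) hvL
    have hg' : g ∈ L2 φhat := by
      refine L2_congr hφhatc (L2_sub hv'
        (mem_L2Trunc_of_bounded (n := n) h1const hφhatc hcm hC).1) ?_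
      filter_upwards [hvg] with z hz
      rw [Pi.sub_apply, hz]
      ring
    have hgT : g ∈ L2Trunc φ n := (h2 ⟨hg', hg⟩).1
    have hcT : cauchyTransform F ∈ L2Trunc φ n :=
      mem_L2Trunc_of_bounded (fun c => L2_subset_L2 hφhatc hφc h1le (h1const c)) hφc hcm hC
    exact L2Trunc_congr hφc (L2Trunc_add hcT hgT) hvg.symm
  obtain ⟨k, hk, hvw⟩ := sub_mem_A2Trunc hφc hFm hM' hF0 hvT hwT hvs hws
  have hφϱ : Continuous fun z => φ z + ϱ z := hφc.add hϱc
  have hsub : L2 φ ⊆ L2 (fun z => φ z + ϱ z) := L2_subset_L2 (c := b) hφc hφϱ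
    fun z => by linarith [(neg_le_abs (ϱ z)).trans (hb z)]
  -- The real factor $e^{\varrho}$ in $w$ cancels the extra $e^{-\varrho}$ in the weight, leaving
  -- the orthogonality of $u$ to $k$ in $L^2_\phi$.
  have horth : ∫ z, Real.exp (-(φ z + ϱ z)) • ((starRingEnd ℂ) (w z) * k z) = 0 := by
    rw [← hu.orthogonal hφc hfm hM hR hk]
    congr 1
    ext z
    have h6 : (Real.exp (-(φ z + ϱ z)) : ℂ) * (Real.exp (ϱ z) : ℂ) = (Real.exp (-φ z) : ℂ) := by
      rw [← Complex.ofReal_mul, ← Real.exp_add]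
      congr 2
      ring
    rw [hw, map_mul, Complex.conj_ofReal, Complex.real_smul, Complex.real_smul, ← h6]
    ring
  have hnorm := eLpNorm_le_add_of_orthogonal hφϱ (hsub hwT.1) (hsub hk.2.1) horth
  have hnorm' : eLpNorm w 2 (weightMeasure fun z => φ z + ϱ z) ≤
      eLpNorm v 2 (weightMeasure fun z => φ z + ϱ z) := by
    refine hnorm.trans (le_of_eq (eLpNorm_congr_ae ?_))
    rw [Filter.EventuallyEq, ae_weightMeasure hφϱ]
    exact hvw.symm
  have hsq : eLpNorm w 2 (weightMeasure fun z => φ z + ϱ z) ^ 2 ≤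
      eLpNorm v 2 (weightMeasure fun z => φ z + ϱ z) ^ 2 := by gcongr
  rw [eLpNorm_weightMeasure_sq hφϱ, eLpNorm_weightMeasure_sq hφϱ] at hsq
  have hwu : ∀ z, ‖w z‖ ^ 2 * Real.exp (-(φ z + ϱ z)) = ‖u z‖ ^ 2 * Real.exp (ϱ z - φ z) := by
    intro z
    rw [hw, norm_mul, Complex.norm_real, Real.norm_of_nonneg (Real.exp_pos _).le, mul_pow,
      sq (Real.exp _), mul_assoc, ← Real.exp_add, ← Real.exp_add]
    congr 2
    ring
  simp only [hwu] at hsq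
  calc ∫⁻ z, ENNReal.ofReal (‖u z‖ ^ 2 * Real.exp (ϱ z - φ z)) ∂areaMeasure
      ≤ ∫⁻ z, ENNReal.ofReal (‖v z‖ ^ 2 * Real.exp (-(φ z + ϱ z))) ∂areaMeasure := hsq
    _ ≤ ENNReal.ofReal (Real.exp α) *
        ∫⁻ z, ENNReal.ofReal (‖v z‖ ^ 2 * Real.exp (-(φhat z + ϱ z))) ∂areaMeasure :=
        lintegral_weight_le (φ₁ := fun z => φhat z + ϱ z) (φ₂ := fun z => φ z + ϱ z)
          (fun z => by linarith [h1le z]) v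
    _ ≤ _ := by gcongr

/-! ### Existence, uniqueness and absorption of the error term. -/

theorem theorem4p1
    (S : Set ℂ) (hS : IsCompact S)
    (φ φhat ϱ : ℂ → ℝ) (hφ : IsC11 φ) (hφhat : IsC11 φhat) (hϱ : IsC11 ϱ)
    (n : ℕ) (hn : 0 < n)
    (α β : ℝ) (hα : 0 ≤ α) (hβ : 0 ≤ β)
    (h1const : ∀ c : ℂ, (fun _ : ℂ => c) ∈ L2 φhat)
    (h1le : ∀ z : ℂ, φhat z ≤ φ z + α)
    (h1ge : ∀ z ∈ S, φ z ≤ β + φhat z)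
    (h2 : A2 φhat ⊆ A2Trunc φ n)
    (h3 : IsStrictlySubharmonic (fun z => φhat z + ϱ z))
    (h4 : ∀ z ∉ S, ∀ᶠ w in nhds z, ϱ w = ϱ z)
    (κ : ℝ) (hκ0 : 0 < κ) (hκ1 : κ < 1)
    (h5 : ∀ᵐ z : ℂ, z ∈ S →
      ‖dbar (fun w => (ϱ w : ℂ)) z‖ ^ 2 / (normLaplacian φhat z + normLaplacian ϱ z)
        ≤ κ ^ 2 / Real.exp (α + β))
    (f : ℂ → ℂ) (hf : ContDiff ℝ ∞ f) (hfS : tsupport f ⊆ S) :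
    (∃ u, IsMinimalSolution φ n f u) ∧
    (∀ u v, IsMinimalSolution φ n f u → IsMinimalSolution φ n f v →
      ∀ᵐ z : ℂ, u z = v z) ∧
    (∀ u, IsMinimalSolution φ n f u →
      ∫⁻ z, ENNReal.ofReal (‖u z‖ ^ 2 * Real.exp (ϱ z - φ z)) ∂areaMeasure
        ≤ ENNReal.ofReal (Real.exp (α + β) / (1 - κ) ^ 2) *
          ∫⁻ z, ENNReal.ofReal (‖f z‖ ^ 2 *
            (Real.exp (ϱ z - φ z) / (normLaplacian φhat z + normLaplacian ϱ z)))
            ∂areaMeasure) := by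
  have hf0 : ∀ z ∉ S, f z = 0 := fun z hz =>
    image_eq_zero_of_notMem_tsupport fun h => hz (hfS h)
  have hfc : HasCompactSupport f := HasCompactSupport.intro hS fun z hz => hf0 z hz
  obtain ⟨M, hM⟩ := hfc.exists_bound_of_continuous hf.continuous
  obtain ⟨R, hRS⟩ := hS.isBounded.exists_norm_le
  have hR : ∀ z, R < ‖z‖ → f z = 0 := fun z hz =>
    hf0 z fun hzS => absurd (hRS z hzS) (not_le.2 hz)
  have hF : StronglyMeasurable f := hf.continuous.stronglyMeasurable
  have hφc := hφ.1.continuous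
  refine ⟨?_, fun u v hu hv => hu.ae_unique hφc hF hM hR hv, fun u hu => ?_⟩
  · have hconst : ∀ c : ℂ, (fun _ : ℂ => c) ∈ L2 φ := fun c =>
      L2_subset_L2 hφhat.1.continuous hφc h1le (h1const c)
    obtain ⟨C, hC⟩ := exists_norm_cauchyTransform_le hF hM hR
    refine exists_isMinimalSolution hφc hF hM hR (mem_L2Trunc_of_bounded hconst hφc
      (stronglyMeasurable_cauchyTransform hF).aestronglyMeasurable hC)
      (isDbarSolution_of_ae_eq hF hM hR (differentiable_const (0 : ℂ)) ?_)
    exact Filter.Eventually.of_forall fun z => (add_zero _).symm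
  set A := ∫⁻ z, ENNReal.ofReal (‖u z‖ ^ 2 * Real.exp (ϱ z - φ z)) ∂areaMeasure with hA
  set B := ∫⁻ z, ENNReal.ofReal (‖f z‖ ^ 2 *
    (Real.exp (ϱ z - φ z) / (normLaplacian φhat z + normLaplacian ϱ z))) ∂areaMeasure with hBdef
  obtain ⟨b, hb⟩ := exists_abs_le_of_locally_constant hS hϱ.1 h4
  by_cases hBtop : B = ⊤
  · have h1 : 0 < 1 - κ := by linarith
    rw [hBtop, ENNReal.mul_top (by simp; positivity)]
    exact le_top
  have huL : AEStronglyMeasurable u volume ∧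
      ∫⁻ z, ENNReal.ofReal (‖u z‖ ^ 2 * Real.exp (-φ z)) ∂areaMeasure < ⊤ :=
    (mem_L2_iff hφc).1 hu.1.1.1
  -- Finiteness of the left side is indispensable for absorbing $\kappa A$; it holds because $u\in
  -- L^2_\phi$ and $\varrho$ is bounded.
  have hAtop : A < ⊤ := by
    have h6 := lintegral_weight_le (φ₁ := φ) (φ₂ := fun z => φ z - ϱ z) (c := b)
      (fun z => by linarith [(le_abs_self (ϱ z)).trans (hb z)]) u
    simp only [neg_sub] at h6
    exact h6.trans_lt (ENNReal.mul_lt_top ENNReal.ofReal_lt_top huL.2)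
  set J := ∫⁻ z, ENNReal.ofReal
      (‖(f z + u z * dbar (fun w => (ϱ w : ℂ)) z) * (Real.exp (ϱ z) : ℂ)‖ ^ 2 *
        (Real.exp (-(φhat z + ϱ z)) / normLaplacian (fun z => φhat z + ϱ z) z))
        ∂areaMeasure with hJ
  -- On $\Sigma$ the $u$ term carries $e^{\beta}\kappa^{-1}\cdot\kappa^2e^{-\alpha-\beta}=\kappa
  -- e^{-\alpha}$, and the later factor $e^{\alpha}$ from Hörmander leaves exactly $\kappa$. Off
  -- $\Sigma$ both $f$ and $\bar\partial\varrho$ vanish.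
  have hpt : ∀ᵐ z : ℂ, ‖(f z + u z * dbar (fun w => (ϱ w : ℂ)) z) * (Real.exp (ϱ z) : ℂ)‖ ^ 2 *
      (Real.exp (-(φhat z + ϱ z)) / normLaplacian (fun z => φhat z + ϱ z) z) ≤
      Real.exp β / (1 - κ) * (‖f z‖ ^ 2 *
        (Real.exp (ϱ z - φ z) / (normLaplacian φhat z + normLaplacian ϱ z))) +
      κ * Real.exp (-α) * (‖u z‖ ^ 2 * Real.exp (ϱ z - φ z)) := by
    filter_upwards [h3, hφhat.ae_normLaplacian_add hϱ, h5] with z hpos hadd h5z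
    rw [hadd] at hpos ⊢
    set D := normLaplacian φhat z + normLaplacian ϱ z with hD
    set d := dbar (fun w => (ϱ w : ℂ)) z with hd
    have h1 : 0 < 1 - κ := by linarith
    by_cases hz : z ∈ S
    · have hsq := norm_add_sq_le_of_lt_one hκ0 hκ1 (f z) (u z * d)
      have hexp : Real.exp (ϱ z) ^ 2 * Real.exp (-(φhat z + ϱ z)) ≤
          Real.exp β * Real.exp (ϱ z - φ z) := by
        rw [sq, ← Real.exp_add, ← Real.exp_add, ← Real.exp_add]
        refine Real.exp_le_exp.2 ?_
        linarith [h1ge z hz]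
      have hdle : ‖d‖ ^ 2 / D ≤ κ ^ 2 * Real.exp (-α) * Real.exp (-β) := by
        refine (h5z hz).trans (le_of_eq ?_)
        rw [Real.exp_add, Real.exp_neg, Real.exp_neg]
        field_simp
      have hββ : Real.exp β * Real.exp (-β) = 1 := by rw [← Real.exp_add]; simp
      rw [norm_mul, mul_pow, Complex.norm_real, Real.norm_of_nonneg (Real.exp_pos _).le]
      calc ‖f z + u z * d‖ ^ 2 * Real.exp (ϱ z) ^ 2 * (Real.exp (-(φhat z + ϱ z)) / D)
          = ‖f z + u z * d‖ ^ 2 * (Real.exp (ϱ z) ^ 2 * Real.exp (-(φhat z + ϱ z))) / D := by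
            ring
        _ ≤ (‖f z‖ ^ 2 / (1 - κ) + ‖u z * d‖ ^ 2 / κ) *
            (Real.exp β * Real.exp (ϱ z - φ z)) / D := by gcongr
        _ = Real.exp β / (1 - κ) * (‖f z‖ ^ 2 * (Real.exp (ϱ z - φ z) / D)) +
            Real.exp β / κ * (‖u z‖ ^ 2 * Real.exp (ϱ z - φ z)) * (‖d‖ ^ 2 / D) := by
            rw [norm_mul]; ring
        _ ≤ Real.exp β / (1 - κ) * (‖f z‖ ^ 2 * (Real.exp (ϱ z - φ z) / D)) +
            Real.exp β / κ * (‖u z‖ ^ 2 * Real.exp (ϱ z - φ z)) *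
              (κ ^ 2 * Real.exp (-α) * Real.exp (-β)) := by gcongr
        _ = _ := by
            have : Real.exp β / κ * (κ ^ 2 * Real.exp (-α) * Real.exp (-β)) =
                κ * Real.exp (-α) * (Real.exp β * Real.exp (-β)) := by
              field_simp
            rw [hββ, mul_one] at this
            linear_combination (‖u z‖ ^ 2 * Real.exp (ϱ z - φ z)) * this
    · have hd0 : d = 0 := dbar_ofReal_eq_zero_of_locally_constant hϱ.1 h4 hz
      rw [hf0 z hz, hd0]
      simp only [mul_zero, add_zero, zero_mul, norm_zero, zero_pow two_ne_zero]
      positivity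
  have hJle : J ≤ ENNReal.ofReal (Real.exp β / (1 - κ)) * B +
      ENNReal.ofReal (κ * Real.exp (-α)) * A := by
    have h1 : 0 < 1 - κ := by linarith
    have hmeasA : AEMeasurable (fun z => ENNReal.ofReal (κ * Real.exp (-α)) *
        ENNReal.ofReal (‖u z‖ ^ 2 * Real.exp (ϱ z - φ z))) areaMeasure := by
      have h7 : AEMeasurable u areaMeasure := huL.1.aemeasurable.mono_ac
        (Measure.ae_le_iff_absolutelyContinuous.1
          (fun s hs => areaMeasure_ae_iff.2 hs))
      have h8 : Measurable fun z => Real.exp (ϱ z - φ z) :=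
        (hϱ.1.continuous.sub hφc).rexp.measurable
      exact (((h7.norm.pow_const 2).mul h8.aemeasurable).ennreal_ofReal).const_mul _
    rw [hBdef, hA, ← lintegral_const_mul' _ _ ENNReal.ofReal_ne_top,
      ← lintegral_const_mul' _ _ ENNReal.ofReal_ne_top, ← lintegral_add_right' _ hmeasA]
    refine lintegral_mono_ae (areaMeasure_ae_iff.2 ?_)
    filter_upwards [hpt] with z hz
    refine (ENNReal.ofReal_le_ofReal hz).trans (ENNReal.ofReal_add_le.trans (le_of_eq ?_))
    rw [ENNReal.ofReal_mul (p := Real.exp β / (1 - κ)) (by positivity), ENNReal.ofReal_mul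
      (p := κ * Real.exp (-α)) (by positivity)]
  have hJtop : J < ⊤ := by
    refine hJle.trans_lt (ENNReal.add_lt_top.2 ⟨?_, ?_⟩)
    · exact ENNReal.mul_lt_top ENNReal.ofReal_lt_top (lt_top_iff_ne_top.2 hBtop)
    · exact ENNReal.mul_lt_top ENNReal.ofReal_lt_top hAtop
  have hAJ := hu.lintegral_le_of_hormander hS hφ hφhat hϱ h1const h1le h2 h3 h4 hf.continuous
    hf0 hJtop
  refine le_mul_of_le_add_mul hAtop.ne (Real.exp_pos _) hκ0 hκ1 (hAJ.trans ?_)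
  calc ENNReal.ofReal (Real.exp α) * J
      ≤ ENNReal.ofReal (Real.exp α) * (ENNReal.ofReal (Real.exp β / (1 - κ)) * B +
        ENNReal.ofReal (κ * Real.exp (-α)) * A) := by gcongr
    _ = _ := by
      rw [mul_add, ← mul_assoc, ← mul_assoc, ← ENNReal.ofReal_mul (Real.exp_pos _).le,
        ← ENNReal.ofReal_mul (Real.exp_pos _).le, Real.exp_add]
      congr 3
      · ring_nf
      · rw [mul_left_comm, ← Real.exp_add]; simp
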